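/- Let $k$ be a field of characteristic zero and let $Q$ be a finite connected quiver with vertex set $Q_0$ and arrow set $Q_1$. Paths are written from right to left: $\beta\alpha$ means first $\alpha$, then $\beta$. A path $\alpha$ has a source $s(\alpha)$ and a target $t(\alpha)$, vertices are the paths of length zero, and a *cycle* is a path $\alpha$ with $s(\alpha)=t(\alpha)$. Let $Z$ be a set of paths of length at least two, none of which is a strict subpath of another, let $\langle Z\rangle$ be the two-sided ideal of the path algebra $kQ$ generated by $Z$, and let $A=kQ/\langle Z\rangle$, which may be infinite-dimensional. Let $B$ be the set of paths of $Q$ which do not contain any path of $Z$. A *circuit* is a class of cycles for the equivalence relation generated by $\gamma_n\cdots\gamma_1\sim\gamma_1\gamma_n\cdots\gamma_2$; it is *trivial* if it is the class of a vertex. For sets $X,Y$ of paths and a circuit $C$, let $(X\odot Y)_C$ be the set of pairs $(\alpha,\beta)$ with $\alpha\in X$, $\beta\in Y$, $t(\beta)=s(\alpha)$, $t(\alpha)=s(\beta)$ and $\alpha\beta\in C$. A circuit $C$ is *strong* if each cycle of $C$ is in $B$, *useful* if $(Q_1\odot B)_C\neq\emptyset$, and *efficient* if it is useful, not strong, and $(Z\odot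 B)_C\neq\emptyset$. Let $W$ be the set of cycles $\gamma=\xi\alpha$ with $\xi\in Z$ in which this occurrence of $\xi$, at the end of $\gamma$, is the only occurrence of a path of $Z$ as a subpath of $\gamma$, and let $w_C=|W\cap C|$. Let $\mathcal S$ be the set of non-trivial strong circuits, $s=|\mathcal S|$, let $\mathcal E$ be the set of efficient circuits, $e=|\mathcal E|$, and let $HH_1(A)$ be the first Hochschild homology of the $k$-algebra $A$ with coefficients in $A$. Then $1\le w_C<\infty$ for each $C\in\mathcal E$, and $$\dim_k HH_1(A)=s+\sum_{C\in\mathcal E}(w_C-1)$$ as an equality of cardinal numbers. In particular, if $\mathcal S$ and $\mathcal E$ are finite, then $HH_1(A)$ is finite-dimensional and $$\dim_k HH_1(A)=s+\sum_{C\in\mathcal E}w_C-e .$$ Both $\mathcal S$ and $\mathcal E$ are finite if $A$ is finite-dimensional. -/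

import Mathlib

/-! ### Degree one Hochschild homology of an associative algebra -/

namespace Hochschild

open scoped TensorProduct

section

variable (k A : Type*) [CommRing k] [Ring A] [Algebra k A]

/-- The Hochschild boundary `A ⊗ A → A`, `a ⊗ b ↦ ab - ba`. -/
noncomputable def boundaryOne : A ⊗[k] A →ₗ[k] A :=
  TensorProduct.lift (LinearMap.mul k A - (LinearMap.mul k A).flip)

/-- The map `b ⊗ c ↦ ab ⊗ c - a ⊗ bc + ca ⊗ b` for a fixed `a`. -/
noncomputable def boundaryTwoAux (a : A) : A ⊗[k] A →ₗ[k] A ⊗[k] A :=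
  TensorProduct.map (LinearMap.mulLeft k a) LinearMap.id
    - (TensorProduct.mk k A A a) ∘ₗ (LinearMap.mul' k A)
    + TensorProduct.map (LinearMap.mulRight k a) LinearMap.id
        ∘ₗ (TensorProduct.comm k A A).toLinearMap

variable {k A} in
theorem boundaryTwoAux_tmul (a b c : A) :
    boundaryTwoAux k A a (b ⊗ₜ[k] c)
      = (a * b) ⊗ₜ[k] c - a ⊗ₜ[k] (b * c) + (c * a) ⊗ₜ[k] b := by
  simp [boundaryTwoAux]

/-- The Hochschild boundary `A ⊗ A ⊗ A → A ⊗ A`,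
`a ⊗ b ⊗ c ↦ ab ⊗ c - a ⊗ bc + ca ⊗ b`. -/
noncomputable def boundaryTwo : A ⊗[k] (A ⊗[k] A) →ₗ[k] A ⊗[k] A :=
  TensorProduct.lift
    { toFun := boundaryTwoAux k A
      map_add' := fun x y => by
        ext b c
        simp [boundaryTwoAux_tmul, add_mul, mul_add, TensorProduct.add_tmul]
        abel
      map_smul' := fun r x => by
        ext b c
        simp [boundaryTwoAux_tmul, smul_sub, TensorProduct.smul_tmul'] }

variable {k A} in
theorem boundaryOne_tmul (a b : A) : boundaryOne k A (a ⊗ₜ[k] b) = a * b - b * a := by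
  simp [boundaryOne]

variable {k A} in
theorem boundaryTwo_tmul (a b c : A) :
    boundaryTwo k A (a ⊗ₜ[k] (b ⊗ₜ[k] c))
      = (a * b) ⊗ₜ[k] c - a ⊗ₜ[k] (b * c) + (c * a) ⊗ₜ[k] b := by
  simp [boundaryTwo, boundaryTwoAux_tmul]

theorem boundaryOne_comp_boundaryTwo : boundaryOne k A ∘ₗ boundaryTwo k A = 0 := by
  ext a b c
  simp [boundaryTwo_tmul, boundaryOne_tmul, mul_assoc]

/-- `HH₁(A) = H₁(A, A)`: one-cycles modulo one-boundaries of the Hochschild complex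
`A ⊗ A ⊗ A → A ⊗ A → A`. -/
abbrev HH1 : Type _ :=
  ↥(LinearMap.ker (boundaryOne k A)) ⧸
    (LinearMap.range (boundaryTwo k A)).submoduleOf (LinearMap.ker (boundaryOne k A))

end

end Hochschild

/-! ### Paths, path algebras, monomial algebras -/

universe u v w

namespace Monomial

open Quiver

section Paths

variable (V : Type u) [Quiver.{v} V]

/-- A path of the quiver, together with its source and its target. -/
@[ext] structure QPath : Type (max u v) where
  src : V
  tgt : V
  path : Path src tgt

/-- A cycle: a path whose source (and target) is `base`; vertices are cycles. -/
@[ext] structure Cycle : Type (max u v) where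
  base : V
  path : Path base base

/-- A pair of paths `(α, β)` with `t(β) = s(α)` and `t(α) = s(β)`. -/
@[ext] structure CyclicPair : Type (max u v) where
  src : V
  tgt : V
  fst : Path src tgt
  snd : Path tgt src

variable {V}

/-- A cycle, seen as a path. -/
def Cycle.toQPath (γ : Cycle V) : QPath V := ⟨γ.base, γ.base, γ.path⟩

/-- `p` is a subpath of `q`. -/
def IsSubpath (p q : QPath V) : Prop :=
  ∃ (u : Path q.src p.src) (v : Path p.tgt q.tgt), q.path = (u.comp p.path).comp v

variable (V) in
/-- `Q₀`, as a set of paths: the trivial paths. -/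
def vertexPaths : Set (QPath V) := {p | p.path.length = 0}

variable (V) in
/-- `Q₁`, as a set of paths: the arrows. -/
def arrowPaths : Set (QPath V) := {p | p.path.length = 1}

/-- `Z` is a set of relations for a monomial algebra: paths of length at least two, none of which
is a strict subpath of another. -/
structure IsRelationSet (Z : Set (QPath V)) : Prop where
  two_le_length : ∀ p ∈ Z, 2 ≤ p.path.length
  minimal : ∀ p ∈ Z, ∀ q ∈ Z, IsSubpath p q → p = q

/-- `B`: the paths which do not contain any path of `Z`. -/
def nonzeroPaths (Z : Set (QPath V)) : Set (QPath V) := {q | ∀ p ∈ Z, ¬ IsSubpath p q}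

end Paths

section Algebra

variable (k : Type w) [Field k] (V : Type u) [Quiver.{v} V]

/-- The path algebra `kQ`: the vector space with basis all the paths of the quiver. -/
def PathAlgebra : Type (max u v w) := QPath V →₀ k

namespace PathAlgebra

noncomputable instance : AddCommGroup (PathAlgebra k V) :=
  inferInstanceAs (AddCommGroup (QPath V →₀ k))

noncomputable instance : Module k (PathAlgebra k V) :=
  inferInstanceAs (Module k (QPath V →₀ k))

variable {V} in
/-- The basis element of `kQ` given by a path. -/
noncomputable def of (p : QPath V) : PathAlgebra k V := (Finsupp.single p (1 : k) : QPath V →₀ k)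

open Classical in
variable {V} in
/-- The product `βα` of the paths `β` and `α`: first `α`, then `β`, if `t(α) = s(β)`, and zero
otherwise. -/
noncomputable def pathMul (β α : QPath V) : PathAlgebra k V :=
  if h : α.tgt = β.src then of k ⟨α.src, β.tgt, (α.path.cast rfl h).comp β.path⟩ else 0

/-- The multiplication of `kQ`, as the bilinear extension of the product of paths. -/
noncomputable def mulHom : PathAlgebra k V →ₗ[k] PathAlgebra k V →ₗ[k] PathAlgebra k V :=
  Finsupp.lift (PathAlgebra k V →ₗ[k] PathAlgebra k V) k (QPath V)
    fun β => Finsupp.lift (PathAlgebra k V) k (QPath V) fun α => pathMul k β α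

noncomputable instance : Mul (PathAlgebra k V) := ⟨fun x y => mulHom k V x y⟩

variable {k V}

theorem mul_def (x y : PathAlgebra k V) : x * y = mulHom k V x y := rfl

theorem of_mul_of (β α : QPath V) : of k β * of k α = pathMul k β α := by
  have key : ∀ {M : Type (max u v w)} [AddCommGroup M] [Module k M] (f : QPath V → M)
      (p : QPath V), Finsupp.lift M k (QPath V) f (Finsupp.single p 1) = f p := by
    intro M _ _ f p
    simp
  have h : mulHom k V (of k β)
      = Finsupp.lift (PathAlgebra k V) k (QPath V) fun α => pathMul k β α := key _ β
  rw [mul_def, h]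
  exact key _ α

theorem pathMul_of_ne {β α : QPath V} (h : α.tgt ≠ β.src) : pathMul k β α = 0 := dif_neg h

theorem pathMul_comp {a b c : V} (q : Path b c) (p : Path a b) :
    pathMul k ⟨b, c, q⟩ ⟨a, b, p⟩ = of k ⟨a, c, p.comp q⟩ := by
  simp [pathMul]

theorem hom_ext {M : Type*} [AddCommMonoid M] [Module k M] {f g : PathAlgebra k V →ₗ[k] M}
    (h : ∀ p, f (of k p) = g (of k p)) : f = g :=
  Finsupp.lhom_ext' fun p => LinearMap.ext_ring (h p)

theorem of_mul_assoc (r q p : QPath V) :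
    of k r * of k q * of k p = of k r * (of k q * of k p) := by
  obtain ⟨a, b, p⟩ := p
  obtain ⟨b', c, q⟩ := q
  obtain ⟨c', d, r⟩ := r
  simp only [of_mul_of]
  by_cases h1 : b = b'
  · subst h1
    rw [pathMul_comp, of_mul_of]
    by_cases h2 : c = c'
    · subst h2
      rw [pathMul_comp, pathMul_comp, of_mul_of, pathMul_comp, Path.comp_assoc]
    · rw [pathMul_of_ne h2, pathMul_of_ne h2, mul_def, map_zero, LinearMap.zero_apply]
  · rw [pathMul_of_ne (k := k) (β := ⟨b', c, q⟩) (α := ⟨a, b, p⟩) h1, mul_def (of k _) 0, map_zero]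
    by_cases h2 : c = c'
    · subst h2
      rw [pathMul_comp, of_mul_of, pathMul_of_ne h1]
    · rw [pathMul_of_ne h2, mul_def, map_zero, LinearMap.zero_apply]

theorem mul_assoc' (x y z : PathAlgebra k V) : x * y * z = x * (y * z) := by
  have key : (mulHom k V).compr₂ (mulHom k V)
      = ((LinearMap.llcomp k _ _ _).comp (mulHom k V)).compl₂ (mulHom k V) := by
    refine hom_ext fun r => hom_ext fun q => hom_ext fun p => ?_
    exact of_mul_assoc r q p
  exact congrArg (fun f => f x y z) key

section Unit

variable [Fintype V]

/-- The unit of `kQ` is the sum of the vertices. -/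
noncomputable instance : One (PathAlgebra k V) := ⟨∑ a : V, of k ⟨a, a, Path.nil⟩⟩

theorem one_def : (1 : PathAlgebra k V) = ∑ a : V, of k ⟨a, a, Path.nil⟩ := rfl

theorem one_mul' (x : PathAlgebra k V) : 1 * x = x := by
  have key : mulHom k V 1 = LinearMap.id := by
    refine hom_ext fun p => ?_
    obtain ⟨a, b, p⟩ := p
    rw [one_def, map_sum, LinearMap.sum_apply, Finset.sum_eq_single b]
    · rw [← mul_def, of_mul_of, pathMul_comp]; rfl
    · intro c _ hc
      rw [← mul_def, of_mul_of, pathMul_of_ne (Ne.symm hc)]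
    · simp
  exact congrArg (fun f => f x) key

theorem mul_one' (x : PathAlgebra k V) : x * 1 = x := by
  have key : (mulHom k V).flip 1 = LinearMap.id := by
    refine hom_ext fun p => ?_
    obtain ⟨a, b, p⟩ := p
    rw [one_def, map_sum, LinearMap.sum_apply, Finset.sum_eq_single a]
    · rw [LinearMap.flip_apply, ← mul_def, of_mul_of, pathMul_comp, Path.nil_comp]; rfl
    · intro c _ hc
      rw [LinearMap.flip_apply, ← mul_def, of_mul_of, pathMul_of_ne hc]
    · simp
  exact congrArg (fun f => f x) key

noncomputable instance : Ring (PathAlgebra k V) :=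
  { (inferInstance : AddCommGroup (PathAlgebra k V)),
    (inferInstance : Mul (PathAlgebra k V)),
    (inferInstance : One (PathAlgebra k V)) with
    left_distrib := fun x y z => map_add (mulHom k V x) y z
    right_distrib := fun x y z => by
      change mulHom k V (x + y) z = mulHom k V x z + mulHom k V y z
      rw [map_add, LinearMap.add_apply]
    zero_mul := fun x => by
      change mulHom k V 0 x = 0
      rw [map_zero, LinearMap.zero_apply]
    mul_zero := fun x => map_zero (mulHom k V x)
    mul_assoc := mul_assoc'
    one_mul := one_mul'
    mul_one := mul_one' }

noncomputable instance : Algebra k (PathAlgebra k V) :=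
  Algebra.ofModule
    (fun r x y => by
      change mulHom k V (r • x) y = r • mulHom k V x y
      rw [map_smul, LinearMap.smul_apply])
    (fun r x y => map_smul (mulHom k V x) r y)

end Unit

end PathAlgebra

variable {V}

/-- The monomial algebra `kQ/⟨Z⟩`, where `⟨Z⟩` is the two-sided ideal generated by the paths
in `Z`. -/
abbrev MonomialAlgebra [Fintype V] (Z : Set (QPath V)) : Type (max u v w) :=
  (TwoSidedIdeal.span (PathAlgebra.of k '' Z)).ringCon.Quotient

end Algebra

/-! ### Circuits -/

section Circuits

variable (V : Type u) [Quiver.{v} V]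

variable {V} in
/-- `Rotates γ δ`: `δ` is the rotated of `γ`, that is, `γ` begins with an arrow `a` followed by a
path `p` and `δ` is `p` followed by `a`. -/
inductive Rotates : Cycle V → Cycle V → Prop
  | mk {x y : V} (a : x ⟶ y) (p : Path y x) : Rotates ⟨x, a.toPath.comp p⟩ ⟨y, p.cons a⟩

/-- Circuits: classes of cycles for the equivalence relation generated by rotation. -/
def Circuit : Type (max u v) := Quotient (Relation.EqvGen.setoid (Rotates (V := V)))

variable {V}

/-- The circuit of a cycle. -/
def Cycle.circuit (γ : Cycle V) : Circuit V :=
  Quotient.mk (Relation.EqvGen.setoid (Rotates (V := V))) γ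

/-- A circuit is trivial if it corresponds to a vertex. -/
def Circuit.IsTrivial (C : Circuit V) : Prop := ∃ x : V, C = Cycle.circuit ⟨x, Path.nil⟩

/-- The circuit of the cycle `αβ` (first `β`, then `α`), for a cyclic pair `(α, β)`. -/
def CyclicPair.circuit (c : CyclicPair V) : Circuit V :=
  Cycle.circuit ⟨c.tgt, c.snd.comp c.fst⟩

/-- `(X ⊙ Y)_C`: the cyclic pairs `(α, β)` with `α ∈ X`, `β ∈ Y` and `αβ ∈ C`. -/
def cyclicPairs (X Y : Set (QPath V)) (C : Circuit V) : Set (CyclicPair V) :=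
  {c | ⟨c.src, c.tgt, c.fst⟩ ∈ X ∧ ⟨c.tgt, c.src, c.snd⟩ ∈ Y ∧ c.circuit = C}

variable (Z : Set (QPath V))

/-- A circuit is useful if `(Q₁ ⊙ B)_C` is not empty. -/
def Circuit.IsUseful (C : Circuit V) : Prop :=
  (cyclicPairs (arrowPaths V) (nonzeroPaths Z) C).Nonempty

/-- A circuit is strong if each of its cycles is in `B`. -/
def Circuit.IsStrong (C : Circuit V) : Prop :=
  ∀ γ : Cycle V, γ.circuit = C → γ.toQPath ∈ nonzeroPaths Z

/-- A circuit is efficient if it is useful, not strong, and `(Z ⊙ B)_C` is not empty. -/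
def Circuit.IsEfficient (C : Circuit V) : Prop :=
  C.IsUseful Z ∧ ¬ C.IsStrong Z ∧ (cyclicPairs Z (nonzeroPaths Z) C).Nonempty

/-- The set of non-trivial strong circuits. -/
def strongCircuits : Set (Circuit V) := {C | ¬ C.IsTrivial ∧ C.IsStrong Z}

/-- The set of efficient circuits. -/
def efficientCircuits : Set (Circuit V) := {C | C.IsEfficient Z}

/-- `W`: the cycles `γ = ξα` with `ξ ∈ Z` (first `α`, then `ξ`) in which this occurrence of `ξ` is
the only occurrence of a path of `Z`. -/
def endCycles : Set (Cycle V) :=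
  {γ | ∃ (x : V) (α : Path γ.base x) (ξ : Path x γ.base),
    ⟨x, γ.base, ξ⟩ ∈ Z ∧ γ.path = α.comp ξ ∧
    ∀ ζ ∈ Z, ∀ (u : Path γ.base ζ.src) (v : Path ζ.tgt γ.base),
      γ.path = (u.comp ζ.path).comp v → u.length = α.length ∧ v.length = 0}

/-- `w_C`: the number of elements of `W ∩ C`. -/
noncomputable def Circuit.weight (C : Circuit V) : ℕ :=
  (endCycles Z ∩ {γ | γ.circuit = C}).ncard

end Circuits

end Monomial

/-!
# The first Hochschild homology of a monomial algebra

The homology of the standard complex `A ⊗ A ⊗ A → A ⊗ A → A` is compared with that of a much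
smaller complex. Write `Q₁ ⊙ B` for the cyclic pairs `(a, β)` of an arrow and a nonzero path; they
are encoded as the cycles `aβ` whose initial part `β` is nonzero (`initCycles`). The small complex
consists of the span of these cycles, the map `aβ ↦ aβ - βa` to `A` (`PathBasis.cycleBoundary`),
and, in place of two-boundaries, the sums of all rotations of the cycles whose circuit is not strong
(`fullSumSpan`). The comparison maps are

* `PathBasis.cycleTensor`, `aβ ↦ β ⊗ a`;
* `PathBasis.tensorCycle`, which takes `α ⊗ bₙ⋯b₁` to the sum of the cycles `bᵢ⋯b₁αbₙ⋯bᵢ₊₁`,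
  because `α ⊗ bₙ⋯b₁` is homologous to the sum of the `bᵢ₋₁⋯b₁αbₙ⋯bᵢ₊₁ ⊗ bᵢ`.

The second is a left inverse of the first, and their other composite is the identity on cycles
modulo boundaries (`PathBasis.sub_cycleTensor_tensorCycle_mem`). A relation `ξ` gives zero in `A`,
so for a cycle `ξβ` the sum attached to `β ⊗ ξ` is a boundary; it is the full rotation sum of `ξβ`,
since the other rotations contain `ξ` in their initial part (`rotationSum_mem`).

The small complex splits along circuits. A chain is a cycle if and only if its coefficients at `γ`
and at its rotation agree whenever that rotation is nonzero
(`PathBasis.cycleBoundary_eq_zero_iff`), that is, if it is constant along arcs of nonzero cycles. In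
a strong circuit there is one arc, the whole circuit, and no boundary. In a circuit that is not
strong each arc starts at exactly one cycle with a nonzero initial part which is itself zero
(`exists_arc_of_not_isStrong`, `Arc.unique`), and by minimality of the relations these are the
elements of `W` (`mem_endCycles_iff`). So the cycles of the small complex on an efficient circuit
`C` have dimension `w_C`. The boundaries on `C` are spanned by one vector: the full rotation sum has
the same coefficient at all the cycles of `C` with a nonzero initial part, namely the exponent of the
circuit (`fullSum_apply`), and this is nonzero in characteristic zero. What is left has a basis
indexed by the non-trivial strong circuits and, for each efficient `C`, by the elements of `W ∩ C`
except one (`PathBasis.hh1Equiv`).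
-/

namespace Monomial

open Quiver

/-! ### Rotation of cycles -/

section Rotation

variable {V : Type u} [Quiver.{v} V]

namespace Cycle

/-- The rotation of a cycle that moves its last arrow to the beginning; a vertex is fixed. -/
def rotate : Cycle V → Cycle V
  | ⟨x, Path.nil⟩ => ⟨x, Path.nil⟩
  | ⟨_, Path.cons p a⟩ => ⟨_, a.toPath.comp p⟩

theorem rotate_cons {x y : V} (p : Path y x) (a : x ⟶ y) :
    rotate ⟨y, p.cons a⟩ = ⟨x, a.toPath.comp p⟩ := rfl

theorem rotate_nil (x : V) : rotate (⟨x, Path.nil⟩ : Cycle V) = ⟨x, Path.nil⟩ := rfl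

/-- The length of a cycle. -/
def length (γ : Cycle V) : ℕ := γ.path.length

theorem rotate_eq_self {γ : Cycle V} (h : γ.length = 0) : γ.rotate = γ := by
  obtain ⟨x, p⟩ := γ
  rw [Path.eq_nil_of_length_zero p h, rotate_nil]

theorem length_rotate (γ : Cycle V) : γ.rotate.length = γ.length := by
  obtain ⟨x, p⟩ := γ
  cases p with
  | nil => rfl
  | cons p a => rw [rotate_cons]; simp [length, add_comm]

theorem length_iterate_rotate (γ : Cycle V) (j : ℕ) : (rotate^[j] γ).length = γ.length := by
  induction j with
  | zero => rfl
  | succ j ih => rw [Function.iterate_succ_apply', length_rotate, ih]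

theorem rotate_iterate_comp {x y : V} (p : Path x y) (q : Path y x) :
    rotate^[q.length] ⟨x, p.comp q⟩ = ⟨y, q.comp p⟩ := by
  induction q with
  | nil => simp
  | cons q a ih =>
    rw [Path.length_cons, Function.iterate_succ_apply, Path.comp_cons, rotate_cons,
      ← Path.comp_assoc, ih]
    simp [Hom.toPath, ← Path.comp_assoc]

theorem rotate_iterate_length (γ : Cycle V) : rotate^[γ.length] γ = γ := by
  obtain ⟨x, p⟩ := γ
  simpa [length] using rotate_iterate_comp Path.nil p

theorem isPeriodicPt_rotate (γ : Cycle V) : Function.IsPeriodicPt rotate γ.length γ :=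
  rotate_iterate_length γ

theorem rotate_injective : Function.Injective (rotate (V := V)) := by
  intro γ δ h
  have hl : γ.length = δ.length := by rw [← length_rotate γ, h, length_rotate]
  rcases hn : γ.length with _ | n
  · rwa [rotate_eq_self hn, rotate_eq_self (hl ▸ hn)] at h
  · have h1 := rotate_iterate_length γ
    have h2 := rotate_iterate_length δ
    rw [hn, Function.iterate_succ_apply] at h1
    rw [← hl, hn, Function.iterate_succ_apply] at h2
    rw [← h1, h, h2]

theorem exists_iterate_rotate (γ : Cycle V) : ∃ j, rotate^[j] γ.rotate = γ := by
  rcases hn : γ.length with _ | n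
  · exact ⟨0, rotate_eq_self hn⟩
  · exact ⟨n, by rw [← Function.iterate_succ_apply, Nat.succ_eq_add_one, ← hn,
      rotate_iterate_length]⟩

theorem exists_rotate_eq (γ : Cycle V) : ∃ δ : Cycle V, δ.rotate = γ := by
  obtain ⟨j, hj⟩ := exists_iterate_rotate γ
  exact ⟨rotate^[j] γ, (Function.iterate_succ_apply' rotate j γ).symm.trans hj⟩

theorem circuit_rotate (γ : Cycle V) : γ.rotate.circuit = γ.circuit := by
  obtain ⟨x, p⟩ := γ
  cases p with
  | nil => rfl
  | cons p a => exact Quotient.sound (Relation.EqvGen.rel _ _ (Rotates.mk a p))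

theorem circuit_iterate_rotate (γ : Cycle V) (j : ℕ) : (rotate^[j] γ).circuit = γ.circuit := by
  induction j with
  | zero => rfl
  | succ j ih => rw [Function.iterate_succ_apply', circuit_rotate, ih]

/-- A function on cycles that is invariant under rotation is constant on circuits. -/
theorem eq_of_circuit_eq {α : Sort*} {f : Cycle V → α} (hf : ∀ γ, f γ.rotate = f γ)
    {γ δ : Cycle V} (h : γ.circuit = δ.circuit) : f γ = f δ := by
  have h' : Relation.EqvGen Rotates γ δ := Quotient.exact h
  clear h
  induction h' with
  | rel x y h =>
    obtain ⟨a, p⟩ := h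
    exact hf ⟨_, p.cons a⟩
  | refl => rfl
  | symm _ _ _ ih => exact ih.symm
  | trans _ _ _ _ _ ih1 ih2 => exact ih1.trans ih2

theorem circuit_eq_iff {γ δ : Cycle V} :
    γ.circuit = δ.circuit ↔ ∃ j, rotate^[j] γ = δ := by
  constructor
  · intro h
    -- the set of cycles from which `δ` is reached by rotations is stable under rotation
    have key : (∃ j, rotate^[j] γ = δ) = (∃ j, rotate^[j] δ = δ) := by
      refine eq_of_circuit_eq (f := fun γ => ∃ j, rotate^[j] γ = δ) (fun γ => propext ?_) h
      constructor
      · rintro ⟨j, hj⟩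
        exact ⟨j + 1, hj⟩
      · rintro ⟨j, hj⟩
        obtain ⟨i, hi⟩ := exists_iterate_rotate γ
        exact ⟨j + i, by rw [Function.iterate_add_apply, hi, hj]⟩
    rw [key]
    exact ⟨0, rfl⟩
  · rintro ⟨j, rfl⟩
    exact (circuit_iterate_rotate γ j).symm

theorem length_eq_of_circuit_eq {γ δ : Cycle V} (h : γ.circuit = δ.circuit) :
    γ.length = δ.length := eq_of_circuit_eq length_rotate h

theorem finite_circuit (C : Circuit V) : {γ : Cycle V | γ.circuit = C}.Finite := by
  induction C using Quotient.inductionOn with | _ δ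
  refine (((Finset.range (δ.length + 1)).finite_toSet).image fun j => rotate^[j] δ).subset ?_
  intro γ hγ
  obtain ⟨j, rfl⟩ := circuit_eq_iff.1 (show δ.circuit = γ.circuit from Eq.symm hγ)
  rcases Nat.eq_zero_or_pos δ.length with h0 | h0
  · exact ⟨0, by simp, (Function.iterate_fixed (rotate_eq_self h0) j).symm⟩
  · refine ⟨j % δ.length, ?_, (isPeriodicPt_rotate δ).iterate_mod_apply j⟩
    have := Nat.mod_lt j h0
    simp only [Finset.coe_range, Set.mem_Iio]
    omega

theorem circuit_isTrivial_iff (γ : Cycle V) : γ.circuit.IsTrivial ↔ γ.length = 0 := by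
  constructor
  · rintro ⟨x, hx⟩
    rw [length_eq_of_circuit_eq hx]
    rfl
  · intro h
    obtain ⟨x, p⟩ := γ
    exact ⟨x, by rw [Path.eq_nil_of_length_zero p h]⟩

theorem circuit_out (C : Circuit V) : Cycle.circuit (Quotient.out C) = C := Quotient.out_eq C

open Classical in
/-- The number of rotations by fewer steps than the length of `γ` that fix `γ`. It is the exponent
of the cycle as a power of a primitive cycle. -/
noncomputable def exponent (γ : Cycle V) : ℕ :=
  ((Finset.range γ.length).filter fun j => rotate^[j] γ = γ).card

theorem exponent_rotate (γ : Cycle V) : γ.rotate.exponent = γ.exponent := by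
  unfold exponent
  rw [length_rotate]
  congr 1
  ext j
  simp only [Finset.mem_filter]
  rw [← Function.iterate_succ_apply, Function.iterate_succ_apply', rotate_injective.eq_iff]

theorem exponent_ne_zero {γ : Cycle V} (h : γ.length ≠ 0) : γ.exponent ≠ 0 := by
  unfold exponent
  rw [Finset.card_ne_zero]
  exact ⟨0, by simpa [Nat.pos_iff_ne_zero] using h⟩

end Cycle

end Rotation

/-! ### Cycles with a nonzero initial part -/

section InitialPart

variable {V : Type u} [Quiver.{v} V]

theorem IsSubpath.refl (p : QPath V) : IsSubpath p p := ⟨Path.nil, Path.nil, by simp⟩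

theorem IsSubpath.trans {p q r : QPath V} (h : IsSubpath p q) (h' : IsSubpath q r) :
    IsSubpath p r := by
  obtain ⟨u, v, h⟩ := h
  obtain ⟨u', v', h'⟩ := h'
  exact ⟨u'.comp u, v.comp v', by simp [h', h]⟩

variable {Z : Set (QPath V)}

theorem nonzeroPaths_of_isSubpath {p q : QPath V} (h : IsSubpath p q) (hq : q ∈ nonzeroPaths Z) :
    p ∈ nonzeroPaths Z := fun ζ hζ h' => hq ζ hζ (h'.trans h)

theorem nonzeroPaths_left {a b c : V} {p : Path a b} {q : Path b c}
    (h : (⟨a, c, p.comp q⟩ : QPath V) ∈ nonzeroPaths Z) :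
    (⟨a, b, p⟩ : QPath V) ∈ nonzeroPaths Z :=
  nonzeroPaths_of_isSubpath (q := ⟨a, c, p.comp q⟩) ⟨Path.nil, q, by simp⟩ h

theorem nonzeroPaths_right {a b c : V} {p : Path a b} {q : Path b c}
    (h : (⟨a, c, p.comp q⟩ : QPath V) ∈ nonzeroPaths Z) :
    (⟨b, c, q⟩ : QPath V) ∈ nonzeroPaths Z :=
  nonzeroPaths_of_isSubpath (q := ⟨a, c, p.comp q⟩) ⟨p, Path.nil, by simp⟩ h

variable (Z) in
/-- The cycles of positive length that are nonzero once their last arrow is removed. Such a cycle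
`aβ` stands for the pair `(a, β)` of `Q₁ ⊙ B`. -/
def initCycles : Set (Cycle V) := {γ | match γ with
  | ⟨_, Path.nil⟩ => False
  | ⟨_, Path.cons p _⟩ => (⟨_, _, p⟩ : QPath V) ∈ nonzeroPaths Z}

theorem mem_initCycles_cons {x y : V} {p : Path y x} {a : x ⟶ y} :
    (⟨y, p.cons a⟩ : Cycle V) ∈ initCycles Z ↔ (⟨y, x, p⟩ : QPath V) ∈ nonzeroPaths Z := Iff.rfl

theorem length_ne_zero_of_mem_initCycles {γ : Cycle V} (h : γ ∈ initCycles Z) :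
    γ.length ≠ 0 := by
  obtain ⟨x, p⟩ := γ
  cases p with
  | nil => exact h.elim
  | cons p a => simp [Cycle.length]

theorem mem_initCycles_of_nonzero {γ : Cycle V} (h0 : γ.length ≠ 0)
    (h : γ.toQPath ∈ nonzeroPaths Z) : γ ∈ initCycles Z := by
  obtain ⟨x, p⟩ := γ
  cases p with
  | nil => exact (h0 rfl).elim
  | cons p a => exact nonzeroPaths_left (q := a.toPath) h

theorem mem_initCycles_of_rotate_nonzero {γ : Cycle V} (h0 : γ.length ≠ 0)
    (h : γ.rotate.toQPath ∈ nonzeroPaths Z) : γ ∈ initCycles Z := by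
  obtain ⟨x, p⟩ := γ
  cases p with
  | nil => exact (h0 rfl).elim
  | cons p a => exact nonzeroPaths_right h

/-- If one path composed with a path `q'` equals another one composed with a shorter path `q`,
then `q` is an end of `q'`. -/
theorem exists_eq_comp_of_comp_eq_comp {a b b' c : V} {p : Path a b} {q : Path b c}
    {p' : Path a b'} {q' : Path b' c} (h : p.comp q = p'.comp q') (hl : q.length ≤ q'.length) :
    ∃ r : Path b' b, q' = r.comp q := by
  induction q with
  | nil => exact ⟨q', rfl⟩
  | cons q e ih =>
    cases q' with
    | nil => simp at hl
    | cons q' e' =>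
      simp only [Path.comp_cons, Path.cons.injEq] at h
      obtain ⟨rfl, h, h'⟩ := h
      obtain ⟨r, rfl⟩ := ih h.eq (by simpa using hl)
      exact ⟨r, by rw [h'.eq]; rfl⟩

/-- The cycles of `W` are the zero cycles that become nonzero once their last arrow is removed. By
minimality of the relations only one relation can end such a cycle. -/
theorem mem_endCycles_iff (hZ : IsRelationSet Z) {γ : Cycle V} :
    γ ∈ endCycles Z ↔ γ ∈ initCycles Z ∧ γ.toQPath ∉ nonzeroPaths Z := by
  constructor
  · rintro ⟨x, α, ξ, hξ, hγ, huniq⟩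
    refine ⟨?_, fun h => h _ hξ ⟨α, Path.nil, hγ⟩⟩
    obtain ⟨y, p⟩ := γ
    cases p with
    | nil =>
      have h1 := congrArg Path.length hγ
      have h2 := hZ.two_le_length _ hξ
      simp at h1
      simp only at h2
      omega
    | cons p a =>
      rintro ζ hζ ⟨u, v, huv⟩
      -- an occurrence within `p` leaves the last arrow `a` after it
      have h := (huniq ζ hζ u (v.cons a) (by simp only at huv; rw [huv]; rfl)).2
      simp at h
  · rintro ⟨h1, h2⟩
    have key : ∀ ζ ∈ Z, ∀ (u : Path γ.base ζ.src) (v : Path ζ.tgt γ.base),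
        γ.path = (u.comp ζ.path).comp v → v.length = 0 := by
      obtain ⟨y, p⟩ := γ
      intro ζ hζ u v huv
      cases v with
      | nil => rfl
      | cons v e =>
        cases p with
        | nil => exact h1.elim
        | cons p a =>
          simp only [Path.comp_cons, Path.cons.injEq] at huv
          obtain ⟨rfl, h, -⟩ := huv
          exact (h1 ζ hζ ⟨u, v, h.eq⟩).elim
    simp only [nonzeroPaths, Set.mem_ofPred_eq, not_forall, not_not] at h2
    obtain ⟨ζ, hζ, u, v, huv⟩ := h2
    have hv := key ζ hζ u v huv
    obtain ⟨a, b, ξ⟩ := ζ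
    obtain ⟨y, p⟩ := γ
    obtain rfl : b = y := v.eq_of_length_zero hv
    obtain rfl := v.eq_nil_of_length_zero hv
    refine ⟨a, u, ξ, hζ, huv, fun ζ' hζ' u' v' h => ?_⟩
    have hv' := key ζ' hζ' u' v' h
    obtain ⟨a', b', ξ'⟩ := ζ'
    obtain rfl : b' = b := v'.eq_of_length_zero hv'
    obtain rfl := v'.eq_nil_of_length_zero hv'
    refine ⟨?_, rfl⟩
    have heq : u.comp ξ = u'.comp ξ' := huv.symm.trans h
    have hlen : u.length + ξ.length = u'.length + ξ'.length :=
      (Path.length_comp u ξ).symm.trans ((congrArg Path.length heq).trans (Path.length_comp u' ξ'))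
    -- two relations that end at the same place are equal, by minimality
    have hξ : (⟨a, b', ξ⟩ : QPath V) = ⟨a', b', ξ'⟩ := by
      rcases le_total ξ.length ξ'.length with hl | hl
      · obtain ⟨r, hr⟩ := exists_eq_comp_of_comp_eq_comp heq hl
        exact hZ.minimal _ hζ _ hζ' ⟨r, Path.nil, hr⟩
      · obtain ⟨r, hr⟩ := exists_eq_comp_of_comp_eq_comp heq.symm hl
        exact (hZ.minimal _ hζ' _ hζ ⟨r, Path.nil, hr⟩).symm
    have := congrArg (fun q : QPath V => q.path.length) hξ
    simp only at this
    change u'.length = u.length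
    omega

theorem finite_endCycles_inter (C : Circuit V) :
    (endCycles Z ∩ {γ | γ.circuit = C}).Finite := (Cycle.finite_circuit C).inter_of_right _

theorem circuit_isUseful_iff {C : Circuit V} :
    C.IsUseful Z ↔ ∃ γ ∈ initCycles Z, γ.circuit = C := by
  constructor
  · rintro ⟨⟨x, y, α, β⟩, hα, hβ, hC⟩
    cases α with
    | nil => simp [arrowPaths] at hα
    | cons α a =>
      cases α with
      | nil => exact ⟨_, hβ, hC⟩
      | cons α a => simp [arrowPaths] at hα
  · rintro ⟨⟨y, p⟩, hγ, hC⟩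
    cases p with
    | nil => exact hγ.elim
    | cons p a => exact ⟨⟨_, _, a.toPath, p⟩, rfl, hγ, hC⟩

end InitialPart

/-! ### Arcs of nonzero cycles in a circuit -/

section Arcs

variable {V : Type u} [Quiver.{v} V] {Z : Set (QPath V)}

variable (Z) in
/-- `δ` is obtained from `γ` by rotations that pass only through nonzero cycles. -/
def Arc (γ δ : Cycle V) : Prop :=
  ∃ j, Cycle.rotate^[j] γ = δ ∧ ∀ i, 0 < i → i ≤ j → (Cycle.rotate^[i] γ).toQPath ∈ nonzeroPaths Z

theorem Arc.refl (γ : Cycle V) : Arc Z γ γ := ⟨0, rfl, fun i h h' => by omega⟩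

theorem Arc.step {γ δ : Cycle V} (h : Arc Z γ δ)
    (hδ : δ.rotate.toQPath ∈ nonzeroPaths Z) : Arc Z γ δ.rotate := by
  obtain ⟨j, rfl, h⟩ := h
  refine ⟨j + 1, Function.iterate_succ_apply' _ _ _, fun i hi hij => ?_⟩
  rcases Nat.lt_or_ge i (j + 1) with h' | h'
  · exact h i hi (by omega)
  · obtain rfl : i = j + 1 := by omega
    rwa [Function.iterate_succ_apply']

theorem Arc.circuit_eq {γ δ : Cycle V} (h : Arc Z γ δ) : γ.circuit = δ.circuit := by
  obtain ⟨j, rfl, -⟩ := h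
  exact (Cycle.circuit_iterate_rotate γ j).symm

/-- Two arcs with the same end are nested, so that they agree if they begin at zero cycles. -/
theorem Arc.unique {γ γ' δ : Cycle V} (h : Arc Z γ δ) (h' : Arc Z γ' δ)
    (hγ : γ.toQPath ∉ nonzeroPaths Z) (hγ' : γ'.toQPath ∉ nonzeroPaths Z) : γ = γ' := by
  obtain ⟨j, hj, h⟩ := h
  obtain ⟨i, hi, h'⟩ := h'
  wlog hij : i ≤ j generalizing γ γ' i j
  · exact (this hγ' hγ i hi h' j hj h (by omega)).symm
  have h1 : Cycle.rotate^[j - i] γ = γ' := by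
    refine Cycle.rotate_injective.iterate i ?_
    rw [← Function.iterate_add_apply, Nat.add_sub_cancel' hij, hj, hi]
  rcases Nat.eq_zero_or_pos (j - i) with h0 | h0
  · rwa [h0] at h1
  · exact (hγ' (h1 ▸ h _ h0 (Nat.sub_le _ _))).elim

/-- In a circuit that is not strong, each arc extends backwards up to a zero cycle. -/
theorem exists_arc_of_not_isStrong (hZ : IsRelationSet Z) {γ : Cycle V} (hγ : γ ∈ initCycles Z)
    (hC : ¬ γ.circuit.IsStrong Z) : ∃ δ ∈ endCycles Z, Arc Z δ γ := by
  classical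
  have hex : ∃ j, ∃ δ : Cycle V, δ.toQPath ∉ nonzeroPaths Z ∧ Cycle.rotate^[j] δ = γ := by
    simp only [Circuit.IsStrong, not_forall] at hC
    obtain ⟨δ, hδ, hδ'⟩ := hC
    obtain ⟨j, hj⟩ := Cycle.circuit_eq_iff.1 hδ
    exact ⟨j, δ, hδ', hj⟩
  obtain ⟨δ, hδ, hj⟩ := Nat.find_spec hex
  have hmin : ∀ i, 0 < i → i ≤ Nat.find hex →
      (Cycle.rotate^[i] δ).toQPath ∈ nonzeroPaths Z := by
    intro i hi hij
    by_contra hcon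
    refine Nat.find_min hex (m := Nat.find hex - i) (by omega) ⟨_, hcon, ?_⟩
    rw [← Function.iterate_add_apply, Nat.sub_add_cancel hij, hj]
  refine ⟨δ, (mem_endCycles_iff hZ).2 ⟨?_, hδ⟩, _, hj, hmin⟩
  rcases Nat.eq_zero_or_pos (Nat.find hex) with h0 | h0
  · rw [h0] at hj
    exact (show δ = γ from hj) ▸ hγ
  · refine mem_initCycles_of_rotate_nonzero ?_ (hmin 1 one_pos h0)
    rw [← Cycle.length_iterate_rotate δ (Nat.find hex), hj]
    exact length_ne_zero_of_mem_initCycles hγ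

/-- For useful circuits that are not strong, the last condition in the definition of efficient
circuits is automatic: such a circuit has a cycle in `W`. -/
theorem isEfficient_iff (hZ : IsRelationSet Z) {C : Circuit V} :
    C.IsEfficient Z ↔ C.IsUseful Z ∧ ¬ C.IsStrong Z := by
  refine ⟨fun h => ⟨h.1, h.2.1⟩, fun h => ⟨h.1, h.2, ?_⟩⟩
  obtain ⟨γ, hγ, rfl⟩ := circuit_isUseful_iff.1 h.1
  obtain ⟨δ, hδ, harc⟩ := exists_arc_of_not_isStrong hZ hγ h.2
  have hδ' := ((mem_endCycles_iff hZ).1 hδ).1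
  obtain ⟨x, α, ξ, hξ, hp, -⟩ := hδ
  refine ⟨⟨x, δ.base, ξ, α⟩, hξ, ?_, ?_⟩
  · obtain ⟨y, p⟩ := δ
    dsimp only at α ξ hξ hp ⊢
    subst hp
    cases ξ with
    | nil => exact absurd (hZ.two_le_length _ hξ) (by simp)
    | cons ξ a => exact nonzeroPaths_left (mem_initCycles_cons.1 hδ')
  · rw [← harc.circuit_eq, CyclicPair.circuit, ← hp]

theorem endCycles_nonempty (hZ : IsRelationSet Z) {C : Circuit V} (hC : C.IsEfficient Z) :
    (endCycles Z ∩ {γ | γ.circuit = C}).Nonempty := by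
  obtain ⟨γ, hγ, rfl⟩ := circuit_isUseful_iff.1 hC.1
  obtain ⟨δ, hδ, harc⟩ := exists_arc_of_not_isStrong hZ hγ hC.2.1
  exact ⟨δ, hδ, harc.circuit_eq⟩

theorem one_le_weight (hZ : IsRelationSet Z) {C : Circuit V} (hC : C.IsEfficient Z) :
    1 ≤ C.weight Z :=
  (Set.ncard_pos (finite_endCycles_inter C)).2 (endCycles_nonempty hZ hC)

theorem isEfficient_of_mem_endCycles (hZ : IsRelationSet Z) {γ : Cycle V}
    (hγ : γ ∈ endCycles Z) : γ.circuit.IsEfficient Z :=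
  have h := (mem_endCycles_iff hZ).1 hγ
  (isEfficient_iff hZ).2 ⟨circuit_isUseful_iff.2 ⟨γ, h.1, rfl⟩, fun h' => h.2 (h' γ rfl)⟩

end Arcs

/-! ### The basis of nonzero paths -/

section PathBasis

/-- A `k`-algebra `A` with a linear basis indexed by the paths that contain no path of `Z`, which
multiplies like the monomial algebra `kQ/⟨Z⟩`: the elements `ι p`, for all the paths `p`, multiply
by concatenation, and `ι p` is zero if `p` contains a path of `Z`. -/
structure PathBasis (k : Type w) [Field k] {V : Type u} [Quiver.{v} V] (Z : Set (QPath V))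
    (A : Type*) [Ring A] [Algebra k A] where
  /-- The element of the algebra given by a path. -/
  ι : QPath V → A
  /-- The basis of the nonzero paths. -/
  basis : Module.Basis (nonzeroPaths Z) k A
  basis_apply : ∀ p, basis p = ι p
  ι_eq_zero : ∀ p ∉ nonzeroPaths Z, ι p = 0
  ι_mul : ∀ {a b c : V} (q : Path b c) (p : Path a b),
    ι ⟨b, c, q⟩ * ι ⟨a, b, p⟩ = ι ⟨a, c, p.comp q⟩
  ι_mul_of_ne : ∀ {q p : QPath V}, p.tgt ≠ q.src → ι q * ι p = 0

variable {k : Type w} [Field k] {V : Type u} [Quiver.{v} V] {Z : Set (QPath V)}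

/-- The coefficient of a path in an element of the path algebra. -/
noncomputable def PathAlgebra.coeff (q : QPath V) : PathAlgebra k V →ₗ[k] k :=
  (Finsupp.lapply q : (QPath V →₀ k) →ₗ[k] k)

open Classical in
theorem PathAlgebra.coeff_of (p q : QPath V) :
    coeff (k := k) q (of k p) = if p = q then 1 else 0 :=
  Finsupp.single_apply

theorem PathAlgebra.mem_span_of (x : PathAlgebra k V) :
    x ∈ Submodule.span k (Set.range (of k : QPath V → PathAlgebra k V)) := by
  have h : x ∈ Submodule.span k
      (Set.range fun p : QPath V => (Finsupp.single p (1 : k) : QPath V →₀ k)) := by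
    have := (Finsupp.basisSingleOne (R := k) (ι := QPath V)).span_eq
    rw [Finsupp.coe_basisSingleOne] at this
    rw [this]
    trivial
  exact h

variable [Fintype V]

/-- The elements of the path algebra in whose expansion only paths containing a path of `Z`
occur. -/
noncomputable def zeroPathIdeal (k : Type w) [Field k] (Z : Set (QPath V)) :
    TwoSidedIdeal (PathAlgebra k V) :=
  TwoSidedIdeal.mk' (Submodule.span k (PathAlgebra.of k '' (nonzeroPaths Z)ᶜ) :
      Set (PathAlgebra k V))
    (Submodule.zero_mem _) (Submodule.add_mem _) (Submodule.neg_mem _)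
    (by
      intro x y hy
      have hx := PathAlgebra.mem_span_of x
      induction hx using Submodule.span_induction with
      | zero => rw [zero_mul]; exact Submodule.zero_mem _
      | add x x' _ _ h h' => rw [add_mul]; exact Submodule.add_mem _ h h'
      | smul c x _ h => rw [smul_mul_assoc]; exact Submodule.smul_mem _ _ h
      | mem x hx =>
        obtain ⟨⟨b', c, q⟩, rfl⟩ := hx
        induction hy using Submodule.span_induction with
        | zero => rw [mul_zero]; exact Submodule.zero_mem _
        | add x x' _ _ h h' => rw [mul_add]; exact Submodule.add_mem _ h h'
        | smul c x _ h => rw [mul_smul_comm]; exact Submodule.smul_mem _ _ h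
        | mem x hx =>
          obtain ⟨⟨a, b, p⟩, hp, rfl⟩ := hx
          rw [PathAlgebra.of_mul_of]
          by_cases h : b = b'
          · subst h
            rw [PathAlgebra.pathMul_comp]
            exact Submodule.subset_span ⟨_, fun h => hp (nonzeroPaths_left h), rfl⟩
          · rw [PathAlgebra.pathMul_of_ne h]
            exact Submodule.zero_mem _)
    (by
      intro y x hy
      have hx := PathAlgebra.mem_span_of x
      induction hx using Submodule.span_induction with
      | zero => rw [mul_zero]; exact Submodule.zero_mem _
      | add x x' _ _ h h' => rw [mul_add]; exact Submodule.add_mem _ h h'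
      | smul c x _ h => rw [mul_smul_comm]; exact Submodule.smul_mem _ _ h
      | mem x hx =>
        obtain ⟨⟨a, b, p⟩, rfl⟩ := hx
        induction hy using Submodule.span_induction with
        | zero => rw [zero_mul]; exact Submodule.zero_mem _
        | add x x' _ _ h h' => rw [add_mul]; exact Submodule.add_mem _ h h'
        | smul c x _ h => rw [smul_mul_assoc]; exact Submodule.smul_mem _ _ h
        | mem x hx =>
          obtain ⟨⟨b', c, q⟩, hq, rfl⟩ := hx
          rw [PathAlgebra.of_mul_of]
          by_cases h : b = b'
          · subst h
            rw [PathAlgebra.pathMul_comp]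
            exact Submodule.subset_span ⟨_, fun h => hq (nonzeroPaths_right h), rfl⟩
          · rw [PathAlgebra.pathMul_of_ne h]
            exact Submodule.zero_mem _)

theorem span_le_zeroPathIdeal :
    TwoSidedIdeal.span (PathAlgebra.of k '' Z) ≤ zeroPathIdeal k Z := by
  rw [TwoSidedIdeal.span_le]
  rintro _ ⟨p, hp, rfl⟩
  rw [SetLike.mem_coe, zeroPathIdeal, TwoSidedIdeal.mem_mk']
  exact Submodule.subset_span ⟨p, fun h => h p hp (IsSubpath.refl p), rfl⟩

theorem of_mem_span {p : QPath V} (hp : p ∉ nonzeroPaths Z) :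
    PathAlgebra.of k p ∈ TwoSidedIdeal.span (PathAlgebra.of k '' Z) := by
  simp only [nonzeroPaths, Set.mem_ofPred_eq, not_forall, not_not] at hp
  obtain ⟨ζ, hζ, u, v, huv⟩ := hp
  obtain ⟨a, b, p⟩ := p
  obtain ⟨c, d, ξ⟩ := ζ
  dsimp only at u v huv
  subst huv
  rw [← PathAlgebra.pathMul_comp, ← PathAlgebra.of_mul_of, ← PathAlgebra.pathMul_comp,
    ← PathAlgebra.of_mul_of]
  exact TwoSidedIdeal.mul_mem_left _ _ _ (TwoSidedIdeal.mul_mem_right _ _ _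
    (TwoSidedIdeal.subset_span ⟨_, hζ, rfl⟩))

/-- The quotient map from the path algebra to the monomial algebra. -/
noncomputable def toMonomialAlgebra (k : Type w) [Field k] (Z : Set (QPath V)) :
    PathAlgebra k V →ₗ[k] MonomialAlgebra k Z where
  toFun := (TwoSidedIdeal.span (PathAlgebra.of k '' Z)).ringCon.mk'
  map_add' := map_add _
  map_smul' _ _ := rfl

theorem toMonomialAlgebra_mul (x y : PathAlgebra k V) :
    toMonomialAlgebra k Z (x * y) = toMonomialAlgebra k Z x * toMonomialAlgebra k Z y := rfl

theorem toMonomialAlgebra_surjective : Function.Surjective (toMonomialAlgebra k Z) :=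
  RingCon.mk'_surjective _

theorem toMonomialAlgebra_eq_zero_iff {x : PathAlgebra k V} :
    toMonomialAlgebra k Z x = 0 ↔ x ∈ TwoSidedIdeal.span (PathAlgebra.of k '' Z) := by
  rw [TwoSidedIdeal.mem_iff]
  exact RingCon.eq _

theorem linearIndependent_nonzeroPaths :
    LinearIndependent k fun p : nonzeroPaths Z => toMonomialAlgebra k Z (PathAlgebra.of k p.1) := by
  classical
  rw [linearIndependent_iff]
  intro l hl
  have h1 : toMonomialAlgebra k Z
      (Finsupp.linearCombination k (fun p : nonzeroPaths Z => PathAlgebra.of k p.1) l) = 0 := by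
    rw [← hl, Finsupp.apply_linearCombination]
    rfl
  have h2 := span_le_zeroPathIdeal (toMonomialAlgebra_eq_zero_iff.1 h1)
  rw [zeroPathIdeal, TwoSidedIdeal.mem_mk'] at h2
  ext q
  -- the coefficient at a nonzero path vanishes on the ideal
  have h3 : ∀ x ∈ Submodule.span k (PathAlgebra.of k '' (nonzeroPaths Z)ᶜ),
      PathAlgebra.coeff (k := k) q.1 x = 0 := by
    intro x hx
    induction hx using Submodule.span_induction with
    | zero => exact map_zero _
    | add x y _ _ hx hy => rw [map_add, hx, hy, add_zero]
    | smul c x _ hx => rw [map_smul, hx, smul_zero]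
    | mem x hx =>
      obtain ⟨p, hp, rfl⟩ := hx
      rw [PathAlgebra.coeff_of, if_neg]
      rintro rfl
      exact hp q.2
  have h4 := h3 _ h2
  rw [Finsupp.linearCombination_apply, map_finsuppSum] at h4
  simpa [PathAlgebra.coeff_of, Finsupp.sum, Subtype.coe_inj] using h4

theorem span_nonzeroPaths :
    ⊤ ≤ Submodule.span k
      (Set.range fun p : nonzeroPaths Z => toMonomialAlgebra k Z (PathAlgebra.of k p.1)) := by
  rintro y -
  obtain ⟨x, rfl⟩ := toMonomialAlgebra_surjective y
  have hx := PathAlgebra.mem_span_of x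
  induction hx using Submodule.span_induction with
  | zero => rw [map_zero]; exact Submodule.zero_mem _
  | add x x' _ _ h h' => rw [map_add]; exact Submodule.add_mem _ h h'
  | smul c x _ h => rw [map_smul]; exact Submodule.smul_mem _ _ h
  | mem x hx =>
    obtain ⟨p, rfl⟩ := hx
    by_cases hp : p ∈ nonzeroPaths Z
    · exact Submodule.subset_span ⟨⟨p, hp⟩, rfl⟩
    · rw [toMonomialAlgebra_eq_zero_iff.2 (of_mem_span hp)]
      exact Submodule.zero_mem _

/-- The nonzero paths form a basis of the monomial algebra. -/
noncomputable def monomialPathBasis (k : Type w) [Field k] (Z : Set (QPath V)) :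
    PathBasis k Z (MonomialAlgebra k Z) where
  ι p := toMonomialAlgebra k Z (PathAlgebra.of k p)
  basis := Module.Basis.mk linearIndependent_nonzeroPaths span_nonzeroPaths
  basis_apply p := by rw [Module.Basis.mk_apply]
  ι_eq_zero p hp := toMonomialAlgebra_eq_zero_iff.2 (of_mem_span hp)
  ι_mul q p := by rw [← toMonomialAlgebra_mul, PathAlgebra.of_mul_of, PathAlgebra.pathMul_comp]
  ι_mul_of_ne h := by
    rw [← toMonomialAlgebra_mul, PathAlgebra.of_mul_of, PathAlgebra.pathMul_of_ne h, map_zero]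

end PathBasis

/-! ### Sums over rotations -/

section RotationSum

variable (k : Type w) [Field k] {V : Type u} [Quiver.{v} V] (Z : Set (QPath V))

open Classical in
/-- The basis vector of a cycle whose initial part is nonzero, and zero for the other cycles. -/
noncomputable def initSingle (γ : Cycle V) : Cycle V →₀ k :=
  if γ ∈ initCycles Z then Finsupp.single γ 1 else 0

/-- For a cycle "first `α`, then `δ`", the sum of its rotations by fewer steps than the length
of `δ`, where only the cycles with a nonzero initial part are kept. -/
noncomputable def rotationSum {y : V} : ∀ {x : V}, Path x y → Path y x → (Cycle V →₀ k)
  | _, _, Path.nil => 0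
  | _, α, Path.cons δ b => initSingle k Z ⟨_, (α.comp δ).cons b⟩ + rotationSum (b.toPath.comp α) δ

/-- The sum of all the rotations of a cycle, where only the cycles with a nonzero initial part
are kept. -/
noncomputable def fullSum (γ : Cycle V) : Cycle V →₀ k := rotationSum k Z Path.nil γ.path

/-- The span of the full rotation sums of the cycles whose circuit is not strong. -/
noncomputable def fullSumSpan : Submodule k (Cycle V →₀ k) :=
  Submodule.span k {x | ∃ γ : Cycle V, ¬ γ.circuit.IsStrong Z ∧ fullSum k Z γ = x}

variable {k Z}

theorem initSingle_of_mem {γ : Cycle V} (h : γ ∈ initCycles Z) :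
    initSingle k Z γ = Finsupp.single γ 1 := if_pos h

theorem initSingle_of_notMem {γ : Cycle V} (h : γ ∉ initCycles Z) :
    initSingle k Z γ = 0 := if_neg h

theorem rotationSum_nil {x : V} (α : Path x x) : rotationSum k Z α Path.nil = 0 := rfl

theorem rotationSum_cons {x y z : V} (α : Path x y) (δ : Path y z) (b : z ⟶ x) :
    rotationSum k Z α (δ.cons b)
      = initSingle k Z ⟨x, (α.comp δ).cons b⟩ + rotationSum k Z (b.toPath.comp α) δ := rfl

/-- This identity says that rotation sums vanish on the Hochschild boundary of `α ⊗ β ⊗ γ`. -/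
theorem rotationSum_comp {x y z : V} (α : Path x y) (γ : Path y z) (β : Path z x) :
    rotationSum k Z α (γ.comp β)
      = rotationSum k Z (α.comp γ) β + rotationSum k Z (β.comp α) γ := by
  induction β with
  | nil => simp [rotationSum_nil]
  | cons β b ih =>
    rw [Path.comp_cons, rotationSum_cons, ih, rotationSum_cons]
    simp [Hom.toPath, ← Path.comp_assoc, add_assoc]

theorem rotationSum_eq_zero {x y : V} {α : Path x y} (δ : Path y x)
    (h : (⟨x, y, α⟩ : QPath V) ∉ nonzeroPaths Z) : rotationSum k Z α δ = 0 := by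
  induction δ with
  | nil => rfl
  | cons δ b ih =>
    rw [rotationSum_cons, ih fun h' => h (nonzeroPaths_right h'), initSingle_of_notMem, add_zero]
    exact fun h' => h (nonzeroPaths_left (mem_initCycles_cons.1 h'))

theorem fullSum_comp {x y : V} (α : Path x y) (β : Path y x) :
    fullSum k Z ⟨x, α.comp β⟩ = rotationSum k Z α β + rotationSum k Z β α := by
  rw [fullSum, rotationSum_comp, Path.nil_comp, Path.comp_nil]

theorem fullSum_rotate (γ : Cycle V) : fullSum k Z γ.rotate = fullSum k Z γ := by
  obtain ⟨x, p⟩ := γ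
  cases p with
  | nil => rfl
  | cons p a =>
    rw [Cycle.rotate_cons, fullSum_comp, add_comm, ← fullSum_comp]
    rfl

theorem fullSum_mem {γ : Cycle V} (h : ¬ γ.circuit.IsStrong Z) :
    fullSum k Z γ ∈ fullSumSpan k Z := Submodule.subset_span ⟨γ, h, rfl⟩

/-- If `δ` is zero, the rotations that break up `α` instead of `δ` do not contribute to the full
sum, because `δ` is contained in their initial part. -/
theorem rotationSum_mem {x y : V} (α : Path x y) {δ : Path y x}
    (h : (⟨y, x, δ⟩ : QPath V) ∉ nonzeroPaths Z) : rotationSum k Z α δ ∈ fullSumSpan k Z := by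
  have h1 := fullSum_comp (k := k) (Z := Z) α δ
  rw [rotationSum_eq_zero α h, add_zero] at h1
  rw [← h1]
  exact fullSum_mem fun hs => h (nonzeroPaths_right (hs ⟨x, α.comp δ⟩ rfl))

theorem rotationSum_eq_sum {x y : V} (α : Path x y) (δ : Path y x) :
    rotationSum k Z α δ
      = ∑ j ∈ Finset.range δ.length, initSingle k Z (Cycle.rotate^[j] ⟨x, α.comp δ⟩) := by
  induction δ with
  | nil => rfl
  | cons δ b ih =>
    rw [rotationSum_cons, ih, Path.length_cons, Finset.sum_range_succ']
    simp [Cycle.rotate_cons, add_comm]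

theorem fullSum_eq_sum (γ : Cycle V) :
    fullSum k Z γ = ∑ j ∈ Finset.range γ.length, initSingle k Z (Cycle.rotate^[j] γ) := by
  rw [fullSum, rotationSum_eq_sum, Path.nil_comp]
  rfl

theorem initSingle_mem_supported (γ : Cycle V) :
    initSingle k Z γ ∈ Finsupp.supported k k (initCycles Z) := by
  by_cases h : γ ∈ initCycles Z
  · rw [initSingle_of_mem h]
    exact Finsupp.single_mem_supported k 1 h
  · rw [initSingle_of_notMem h]
    exact Submodule.zero_mem _

theorem rotationSum_mem_supported {x y : V} (α : Path x y) (δ : Path y x) :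
    rotationSum k Z α δ ∈ Finsupp.supported k k (initCycles Z) := by
  rw [rotationSum_eq_sum]
  exact Submodule.sum_mem _ fun j _ => initSingle_mem_supported _

end RotationSum

/-! ### Comparison with the Hochschild complex -/

section Comparison

open scoped TensorProduct

open Hochschild

variable {k : Type w} [Field k] {V : Type u} [Quiver.{v} V] {Z : Set (QPath V)}
variable {A : Type*} [Ring A] [Algebra k A]

theorem range_boundaryTwo_le_iff {M : Type*} [AddCommGroup M] [Module k M]
    {f : A ⊗[k] A →ₗ[k] M} {N : Submodule k M} {ι : Type*} (b : Module.Basis ι k A)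
    (h : ∀ i j l, f (boundaryTwo k A (b i ⊗ₜ (b j ⊗ₜ b l))) ∈ N) :
    LinearMap.range (boundaryTwo k A) ≤ N.comap f := by
  have key : N.mkQ ∘ₗ f ∘ₗ boundaryTwo k A = 0 := by
    refine (b.tensorProduct (b.tensorProduct b)).ext ?_
    rintro ⟨i, j, l⟩
    simpa [Module.Basis.tensorProduct_apply] using h i j l
  rintro _ ⟨x, rfl⟩
  have := LinearMap.congr_fun key x
  simpa using this

namespace PathBasis

variable (P : PathBasis k Z A)

theorem ι_cons {x y z : V} (p : Path x y) (a : y ⟶ z) :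
    P.ι ⟨x, z, p.cons a⟩ = P.ι ⟨y, z, a.toPath⟩ * P.ι ⟨x, y, p⟩ := (P.ι_mul a.toPath p).symm

theorem ι_mul_nil {x y : V} (p : Path x y) :
    P.ι ⟨x, y, p⟩ * P.ι ⟨x, x, Path.nil⟩ = P.ι ⟨x, y, p⟩ := by
  rw [P.ι_mul, Path.nil_comp]

theorem nil_mul_ι {x y : V} (p : Path x y) :
    P.ι ⟨y, y, Path.nil⟩ * P.ι ⟨x, y, p⟩ = P.ι ⟨x, y, p⟩ := by
  rw [P.ι_mul, Path.comp_nil]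

/-- The linear map that takes a cycle `γ` to the difference of `γ` and its rotation. -/
noncomputable def cycleBoundary : (Cycle V →₀ k) →ₗ[k] A :=
  Finsupp.linearCombination k fun γ => P.ι γ.toQPath - P.ι γ.rotate.toQPath

theorem cycleBoundary_single (γ : Cycle V) :
    P.cycleBoundary (Finsupp.single γ 1) = P.ι γ.toQPath - P.ι γ.rotate.toQPath := by
  simp [cycleBoundary]

theorem cycleBoundary_initSingle (γ : Cycle V) :
    P.cycleBoundary (initSingle k Z γ) = P.ι γ.toQPath - P.ι γ.rotate.toQPath := by
  by_cases h : γ ∈ initCycles Z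
  · rw [initSingle_of_mem h, cycleBoundary_single]
  · rw [initSingle_of_notMem h, map_zero]
    rcases Nat.eq_zero_or_pos γ.length with h0 | h0
    · rw [Cycle.rotate_eq_self h0, sub_self]
    · rw [P.ι_eq_zero _ fun h' => h (mem_initCycles_of_nonzero h0.ne' h'),
        P.ι_eq_zero _ fun h' => h (mem_initCycles_of_rotate_nonzero h0.ne' h'), sub_self]

theorem cycleBoundary_rotationSum {x y : V} (α : Path x y) (δ : Path y x) :
    P.cycleBoundary (rotationSum k Z α δ) = P.ι ⟨x, x, α.comp δ⟩ - P.ι ⟨y, y, δ.comp α⟩ := by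
  induction δ with
  | nil => simp [rotationSum_nil]
  | cons δ b ih =>
    rw [rotationSum_cons, map_add, ih, cycleBoundary_initSingle, Cycle.rotate_cons]
    simp [Cycle.toQPath, Hom.toPath, ← Path.comp_assoc]

/-- The linear map that takes a cycle `aβ`, with last arrow `a`, to `β ⊗ a`. -/
noncomputable def cycleTensor : (Cycle V →₀ k) →ₗ[k] A ⊗[k] A :=
  Finsupp.linearCombination k fun γ => match γ with
    | ⟨_, Path.nil⟩ => 0
    | ⟨_, Path.cons p a⟩ => P.ι ⟨_, _, p⟩ ⊗ₜ P.ι ⟨_, _, a.toPath⟩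

theorem cycleTensor_single_cons {x y : V} (p : Path y x) (a : x ⟶ y) :
    P.cycleTensor (Finsupp.single ⟨y, p.cons a⟩ 1) = P.ι ⟨y, x, p⟩ ⊗ₜ P.ι ⟨x, y, a.toPath⟩ := by
  simp [cycleTensor]

theorem cycleTensor_single_nil (x : V) :
    P.cycleTensor (Finsupp.single ⟨x, Path.nil⟩ 1) = 0 := by
  simp [cycleTensor]

theorem cycleTensor_initSingle_cons {x y : V} (p : Path y x) (a : x ⟶ y) :
    P.cycleTensor (initSingle k Z ⟨y, p.cons a⟩) = P.ι ⟨y, x, p⟩ ⊗ₜ P.ι ⟨x, y, a.toPath⟩ := by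
  by_cases h : (⟨y, p.cons a⟩ : Cycle V) ∈ initCycles Z
  · rw [initSingle_of_mem h, cycleTensor_single_cons]
  · rw [initSingle_of_notMem h, map_zero, P.ι_eq_zero _ h, TensorProduct.zero_tmul]

theorem boundaryOne_cycleTensor (x : Cycle V →₀ k) :
    boundaryOne k A (P.cycleTensor x) = - P.cycleBoundary x := by
  have key : boundaryOne k A ∘ₗ P.cycleTensor = - P.cycleBoundary := by
    refine Finsupp.lhom_ext' fun γ => LinearMap.ext_ring ?_
    change boundaryOne k A (P.cycleTensor (Finsupp.single γ 1))
      = - P.cycleBoundary (Finsupp.single γ 1)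
    obtain ⟨y, p⟩ := γ
    rw [cycleBoundary_single]
    cases p with
    | nil => rw [cycleTensor_single_nil, map_zero, Cycle.rotate_nil, sub_self, neg_zero]
    | cons p a =>
      rw [cycleTensor_single_cons, boundaryOne_tmul, Cycle.rotate_cons, P.ι_mul, P.ι_mul, neg_sub]
      rfl
  exact LinearMap.congr_fun key x

/-- Modulo Hochschild boundaries, `α ⊗ bₙ⋯b₁` is the sum of the `bᵢ₋₁⋯b₁αbₙ⋯bᵢ₊₁ ⊗ bᵢ`. -/
theorem tmul_sub_cycleTensor_mem {x y : V} (α : Path x y) (δ : Path y x) :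
    P.ι ⟨x, y, α⟩ ⊗ₜ P.ι ⟨y, x, δ⟩ - P.cycleTensor (rotationSum k Z α δ)
      ∈ LinearMap.range (boundaryTwo k A) := by
  induction δ with
  | nil =>
    refine ⟨P.ι ⟨y, y, α⟩ ⊗ₜ (P.ι ⟨y, y, Path.nil⟩ ⊗ₜ P.ι ⟨y, y, Path.nil⟩), ?_⟩
    rw [boundaryTwo_tmul, P.ι_mul_nil, P.ι_mul_nil, P.nil_mul_ι, rotationSum_nil, map_zero]
    abel
  | @cons z x δ b ih =>
    have h : boundaryTwo k A
        (P.ι ⟨x, y, α⟩ ⊗ₜ (P.ι ⟨z, x, b.toPath⟩ ⊗ₜ P.ι ⟨y, z, δ⟩))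
        ∈ LinearMap.range (boundaryTwo k A) := ⟨_, rfl⟩
    rw [boundaryTwo_tmul, P.ι_mul, ← P.ι_cons, P.ι_mul] at h
    have h' := Submodule.sub_mem _ (ih (b.toPath.comp α)) h
    rw [rotationSum_cons, map_add, cycleTensor_initSingle_cons]
    convert h' using 1
    abel

theorem cycleTensor_mem {x : Cycle V →₀ k} (hx : x ∈ fullSumSpan k Z) :
    P.cycleTensor x ∈ LinearMap.range (boundaryTwo k A) := by
  have h : fullSumSpan k Z ≤ (LinearMap.range (boundaryTwo k A)).comap P.cycleTensor := by
    refine Submodule.span_le.2 ?_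
    rintro _ ⟨γ, hγ, rfl⟩
    simp only [Circuit.IsStrong, not_forall] at hγ
    obtain ⟨δ, hδ, hδ'⟩ := hγ
    rw [← Cycle.eq_of_circuit_eq (f := fullSum k Z) fullSum_rotate hδ]
    have h1 := P.tmul_sub_cycleTensor_mem Path.nil δ.path
    rw [P.ι_eq_zero ⟨_, _, δ.path⟩ hδ', TensorProduct.tmul_zero, zero_sub] at h1
    exact (Submodule.neg_mem_iff (LinearMap.range (boundaryTwo k A))).1 h1
  exact h hx

open Classical in
variable (k Z) in
/-- The sum of rotations attached to two paths, which is zero unless they form a cyclic pair. -/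
noncomputable def pairSum (α β : QPath V) : Cycle V →₀ k :=
  if h : β.src = α.tgt ∧ β.tgt = α.src then rotationSum k Z α.path (β.path.cast h.1 h.2) else 0

theorem pairSum_of_not {α β : QPath V} (h : ¬ (β.src = α.tgt ∧ β.tgt = α.src)) :
    pairSum k Z α β = 0 := dif_neg h

theorem pairSum_mk {x y : V} (α : Path x y) (β : Path y x) :
    pairSum k Z ⟨x, y, α⟩ ⟨y, x, β⟩ = rotationSum k Z α β := by
  simp [pairSum]

theorem pairSum_left_eq_zero {α β : QPath V} (h : α ∉ nonzeroPaths Z) :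
    pairSum k Z α β = 0 := by
  by_cases hc : β.src = α.tgt ∧ β.tgt = α.src
  · obtain ⟨x, y, α⟩ := α
    obtain ⟨y', x', β⟩ := β
    obtain ⟨rfl, rfl⟩ := hc
    exact (pairSum_mk α β).trans (rotationSum_eq_zero β h)
  · exact pairSum_of_not hc

theorem pairSum_right_mem {α β : QPath V} (h : β ∉ nonzeroPaths Z) :
    pairSum k Z α β ∈ fullSumSpan k Z := by
  by_cases hc : β.src = α.tgt ∧ β.tgt = α.src
  · obtain ⟨x, y, α⟩ := α
    obtain ⟨y', x', β⟩ := β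
    obtain ⟨rfl, rfl⟩ := hc
    exact (pairSum_mk (k := k) (Z := Z) α β).symm ▸ rotationSum_mem α h
  · rw [pairSum_of_not hc]
    exact Submodule.zero_mem _

/-- The linear map that takes `α ⊗ bₙ⋯b₁`, for nonzero paths which form a cyclic pair, to the sum
of the cycles `bᵢ⋯b₁αbₙ⋯bᵢ₊₁` with a nonzero initial part; it vanishes on the other pairs of nonzero
paths. -/
noncomputable def tensorCycle : A ⊗[k] A →ₗ[k] (Cycle V →₀ k) :=
  TensorProduct.lift (P.basis.constr k fun α => P.basis.constr k fun β => pairSum k Z α.1 β.1)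

theorem tensorCycle_basis (α β : nonzeroPaths Z) :
    P.tensorCycle (P.basis α ⊗ₜ P.basis β) = pairSum k Z α.1 β.1 := by
  simp [tensorCycle]

theorem tensorCycle_of_mem {α β : QPath V} (hα : α ∈ nonzeroPaths Z) (hβ : β ∈ nonzeroPaths Z) :
    P.tensorCycle (P.ι α ⊗ₜ P.ι β) = pairSum k Z α β := by
  have := P.tensorCycle_basis ⟨α, hα⟩ ⟨β, hβ⟩
  rwa [P.basis_apply, P.basis_apply] at this

theorem tensorCycle_sub_pairSum_mem (α β : QPath V) :
    P.tensorCycle (P.ι α ⊗ₜ P.ι β) - pairSum k Z α β ∈ fullSumSpan k Z := by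
  by_cases hα : α ∈ nonzeroPaths Z
  · by_cases hβ : β ∈ nonzeroPaths Z
    · rw [P.tensorCycle_of_mem hα hβ, sub_self]
      exact Submodule.zero_mem _
    · rw [P.ι_eq_zero β hβ, TensorProduct.tmul_zero, map_zero, zero_sub]
      exact Submodule.neg_mem _ (pairSum_right_mem hβ)
  · rw [P.ι_eq_zero α hα, TensorProduct.zero_tmul, map_zero, pairSum_left_eq_zero hα, sub_self]
    exact Submodule.zero_mem _

theorem tensorCycle_mem_of_not {α β : QPath V} (h : ¬ (β.src = α.tgt ∧ β.tgt = α.src)) :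
    P.tensorCycle (P.ι α ⊗ₜ P.ι β) ∈ fullSumSpan k Z := by
  have := P.tensorCycle_sub_pairSum_mem α β
  rwa [pairSum_of_not h, sub_zero] at this

/-- A tensor `qp ⊗ r` maps into the span of the full sums unless the three paths close up. -/
theorem tensorCycle_mul_tmul_mem {q p r : QPath V}
    (h : ¬ (p.tgt = q.src ∧ r.tgt = p.src ∧ q.tgt = r.src)) :
    P.tensorCycle ((P.ι q * P.ι p) ⊗ₜ P.ι r) ∈ fullSumSpan k Z := by
  by_cases h1 : p.tgt = q.src
  · obtain ⟨a, b, p⟩ := p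
    obtain ⟨b', c, q⟩ := q
    obtain rfl : b = b' := h1
    rw [P.ι_mul]
    exact P.tensorCycle_mem_of_not fun h' => h ⟨rfl, h'.2, h'.1.symm⟩
  · rw [P.ι_mul_of_ne h1, TensorProduct.zero_tmul, map_zero]
    exact Submodule.zero_mem _

theorem tensorCycle_tmul_mul_mem {q p r : QPath V}
    (h : ¬ (p.tgt = q.src ∧ r.tgt = p.src ∧ q.tgt = r.src)) :
    P.tensorCycle (P.ι r ⊗ₜ (P.ι q * P.ι p)) ∈ fullSumSpan k Z := by
  by_cases h1 : p.tgt = q.src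
  · obtain ⟨a, b, p⟩ := p
    obtain ⟨b', c, q⟩ := q
    obtain rfl : b = b' := h1
    rw [P.ι_mul]
    exact P.tensorCycle_mem_of_not fun h' => h ⟨rfl, h'.1.symm, h'.2⟩
  · rw [P.ι_mul_of_ne h1, TensorProduct.tmul_zero, map_zero]
    exact Submodule.zero_mem _

theorem tensorCycle_boundaryTwo_mem :
    LinearMap.range (boundaryTwo k A) ≤ (fullSumSpan k Z).comap P.tensorCycle := by
  refine range_boundaryTwo_le_iff P.basis fun i j l => ?_
  rw [P.basis_apply, P.basis_apply, P.basis_apply, boundaryTwo_tmul]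
  generalize i.1 = a
  generalize j.1 = b
  generalize l.1 = c
  by_cases h : b.tgt = a.src ∧ c.tgt = b.src ∧ a.tgt = c.src
  · obtain ⟨x, y, a⟩ := a
    obtain ⟨z, x', b⟩ := b
    obtain ⟨y', z', c⟩ := c
    obtain ⟨h1, h2, h3⟩ := h
    dsimp only at h1 h2 h3
    subst h1 h2 h3
    rw [P.ι_mul, P.ι_mul, P.ι_mul]
    have hab := P.tensorCycle_sub_pairSum_mem ⟨z', y, b.comp a⟩ ⟨y, z', c⟩
    have hbc := P.tensorCycle_sub_pairSum_mem ⟨x', y, a⟩ ⟨y, x', c.comp b⟩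
    have hca := P.tensorCycle_sub_pairSum_mem ⟨x', z', a.comp c⟩ ⟨z', x', b⟩
    rw [pairSum_mk] at hab hbc hca
    rw [rotationSum_comp] at hbc
    rw [map_add, map_sub]
    convert Submodule.add_mem _ (Submodule.sub_mem _ hab hbc) hca using 1
    abel
  · rw [map_add, map_sub]
    refine Submodule.add_mem _ (Submodule.sub_mem _ (P.tensorCycle_mul_tmul_mem h)
      (P.tensorCycle_tmul_mul_mem fun h' => h ⟨h'.2.2, h'.1, h'.2.1⟩))
      (P.tensorCycle_mul_tmul_mem fun h' => h ⟨h'.2.1, h'.2.2, h'.1⟩)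

theorem toPath_mem_nonzeroPaths (hZ : IsRelationSet Z) {x y : V} (a : x ⟶ y) :
    (⟨x, y, a.toPath⟩ : QPath V) ∈ nonzeroPaths Z := by
  rintro ζ hζ ⟨u, v, h⟩
  have h1 := congrArg Path.length h
  have h2 := hZ.two_le_length ζ hζ
  simp only [Path.length_toPath, Path.length_comp] at h1
  omega

theorem tensorCycle_cycleTensor (hZ : IsRelationSet Z) {x : Cycle V →₀ k}
    (hx : x ∈ Finsupp.supported k k (initCycles Z)) : P.tensorCycle (P.cycleTensor x) = x := by
  rw [Finsupp.supported_eq_span_single] at hx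
  induction hx using Submodule.span_induction with
  | zero => rw [map_zero, map_zero]
  | add x y _ _ hx hy => rw [map_add, map_add, hx, hy]
  | smul c x _ hx => rw [map_smul, map_smul, hx]
  | mem x hx =>
    obtain ⟨⟨y, p⟩, hγ, rfl⟩ := hx
    cases p with
    | nil => exact hγ.elim
    | cons p a =>
      rw [cycleTensor_single_cons, P.tensorCycle_of_mem hγ (toPath_mem_nonzeroPaths hZ a),
        pairSum_mk, Hom.toPath, rotationSum_cons, rotationSum_nil, add_zero, Path.comp_nil,
        initSingle_of_mem hγ]

theorem tensorCycle_mem_supported (x : A ⊗[k] A) :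
    P.tensorCycle x ∈ Finsupp.supported k k (initCycles Z) := by
  have key : (Finsupp.supported k k (initCycles Z)).mkQ ∘ₗ P.tensorCycle = 0 := by
    refine (P.basis.tensorProduct P.basis).ext ?_
    rintro ⟨⟨α, hα⟩, ⟨β, hβ⟩⟩
    rw [Module.Basis.tensorProduct_apply, LinearMap.comp_apply, tensorCycle_basis,
      LinearMap.zero_apply, Submodule.mkQ_apply, Submodule.Quotient.mk_eq_zero]
    by_cases hc : β.src = α.tgt ∧ β.tgt = α.src
    · obtain ⟨x, y, α⟩ := α
      obtain ⟨y', x', β⟩ := β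
      obtain ⟨rfl, rfl⟩ := hc
      exact (pairSum_mk (k := k) (Z := Z) α β).symm ▸ rotationSum_mem_supported α β
    · rw [pairSum_of_not hc]
      exact Submodule.zero_mem _
  have := LinearMap.congr_fun key x
  simpa using this

open Classical in
/-- The projection of the algebra onto the span of the nonzero cycles. -/
noncomputable def cyclePart : A →ₗ[k] A :=
  P.basis.constr k fun p => if p.1.src = p.1.tgt then P.ι p.1 else 0

open Classical in
theorem cyclePart_ι (p : QPath V) :
    P.cyclePart (P.ι p) = if p.src = p.tgt then P.ι p else 0 := by
  by_cases hp : p ∈ nonzeroPaths Z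
  · have := P.basis.constr_basis k (fun p => if p.1.src = p.1.tgt then P.ι p.1 else 0) ⟨p, hp⟩
    rwa [P.basis_apply] at this
  · simp [P.ι_eq_zero p hp]

open Classical in
/-- The linear map that takes a nonzero path `p` which is not a cycle to `p ⊗ s(p)`, and the nonzero
cycles to zero. -/
noncomputable def sourceTensor : A →ₗ[k] A ⊗[k] A :=
  P.basis.constr k fun p => if p.1.src = p.1.tgt then 0 else
    P.ι p.1 ⊗ₜ P.ι ⟨p.1.src, p.1.src, Path.nil⟩

open Classical in
theorem sourceTensor_ι (p : QPath V) :
    P.sourceTensor (P.ι p) = if p.src = p.tgt then 0 else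
      P.ι p ⊗ₜ P.ι ⟨p.src, p.src, Path.nil⟩ := by
  by_cases hp : p ∈ nonzeroPaths Z
  · have := P.basis.constr_basis k (fun p => if p.1.src = p.1.tgt then 0 else
      P.ι p.1 ⊗ₜ[k] P.ι ⟨p.1.src, p.1.src, Path.nil⟩) ⟨p, hp⟩
    rwa [P.basis_apply] at this
  · simp [P.ι_eq_zero p hp]

theorem cycleBoundary_tensorCycle (x : A ⊗[k] A) :
    P.cycleBoundary (P.tensorCycle x) = - P.cyclePart (boundaryOne k A x) := by
  have key : P.cycleBoundary ∘ₗ P.tensorCycle = - (P.cyclePart ∘ₗ boundaryOne k A) := by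
    refine (P.basis.tensorProduct P.basis).ext ?_
    rintro ⟨α, β⟩
    rw [Module.Basis.tensorProduct_apply, LinearMap.comp_apply, tensorCycle_basis,
      LinearMap.neg_apply, LinearMap.comp_apply, boundaryOne_tmul, P.basis_apply, P.basis_apply]
    generalize α.1 = α
    generalize β.1 = β
    obtain ⟨x, y, α⟩ := α
    obtain ⟨y', x', β⟩ := β
    have hβα : y' ≠ y → P.ι ⟨y', x', β⟩ * P.ι ⟨x, y, α⟩ = 0 :=
      fun h => P.ι_mul_of_ne h.symm
    by_cases h1 : y' = y <;> by_cases h2 : x' = x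
    · subst h1 h2
      rw [pairSum_mk, cycleBoundary_rotationSum, P.ι_mul, P.ι_mul, map_sub, cyclePart_ι,
        cyclePart_ι, if_pos rfl, if_pos rfl, neg_sub]
    · subst h1
      rw [pairSum_of_not fun h => h2 h.2, P.ι_mul_of_ne h2, P.ι_mul, zero_sub, map_neg,
        cyclePart_ι, if_neg (Ne.symm h2), map_zero, neg_zero, neg_zero]
    · subst h2
      rw [pairSum_of_not fun h => h1 h.1, hβα h1, P.ι_mul, sub_zero,
        cyclePart_ι, if_neg h1, map_zero, neg_zero]
    · rw [pairSum_of_not fun h => h1 h.1, hβα h1, P.ι_mul_of_ne h2, sub_zero,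
        map_zero, map_zero, neg_zero]
  exact LinearMap.congr_fun key x

/-- Modulo Hochschild boundaries, the two comparison maps are mutually inverse up to a term that
depends only on the Hochschild boundary. -/
theorem sub_cycleTensor_tensorCycle_mem (x : A ⊗[k] A) :
    x - P.cycleTensor (P.tensorCycle x) - P.sourceTensor (boundaryOne k A x)
      ∈ LinearMap.range (boundaryTwo k A) := by
  set R := LinearMap.range (boundaryTwo k A) with hR
  have hmem : ∀ y, boundaryTwo k A y ∈ R := fun y => ⟨y, rfl⟩
  have key : R.mkQ ∘ₗ (LinearMap.id - P.cycleTensor ∘ₗ P.tensorCycle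
      - P.sourceTensor ∘ₗ boundaryOne k A) = 0 := by
    refine (P.basis.tensorProduct P.basis).ext ?_
    rintro ⟨α, β⟩
    rw [Module.Basis.tensorProduct_apply, LinearMap.zero_apply, LinearMap.comp_apply,
      Submodule.mkQ_apply, Submodule.Quotient.mk_eq_zero, LinearMap.sub_apply,
      LinearMap.sub_apply, LinearMap.id_apply, LinearMap.comp_apply, LinearMap.comp_apply,
      tensorCycle_basis, boundaryOne_tmul, P.basis_apply, P.basis_apply]
    generalize α.1 = α
    generalize β.1 = β
    obtain ⟨x, y, α⟩ := α
    obtain ⟨y', x', β⟩ := β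
    have hβα : y' ≠ y → P.ι ⟨y', x', β⟩ * P.ι ⟨x, y, α⟩ = 0 :=
      fun h => P.ι_mul_of_ne h.symm
    by_cases h1 : y' = y <;> by_cases h2 : x' = x
    · subst h1 h2
      rw [pairSum_mk, P.ι_mul, P.ι_mul, map_sub, sourceTensor_ι, sourceTensor_ι, if_pos rfl,
        if_pos rfl, sub_zero, sub_zero]
      exact P.tmul_sub_cycleTensor_mem α β
    · -- only `βα` can be nonzero: `α ⊗ β` is homologous to `βα ⊗ t(β)`, hence to `-βα ⊗ s(α)`
      subst h1
      rw [pairSum_of_not fun h => h2 h.2, map_zero, sub_zero, P.ι_mul_of_ne h2, P.ι_mul, zero_sub,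
        map_neg, sourceTensor_ι, if_neg (Ne.symm h2), sub_neg_eq_add]
      have e1 := hmem (P.ι ⟨x, y', α⟩ ⊗ₜ (P.ι ⟨x', x', Path.nil⟩ ⊗ₜ P.ι ⟨y', x', β⟩))
      have e2 := hmem (P.ι ⟨x, x', α.comp β⟩ ⊗ₜ
        (P.ι ⟨x, x, Path.nil⟩ ⊗ₜ P.ι ⟨x', x', Path.nil⟩))
      rw [boundaryTwo_tmul, P.ι_mul_of_ne h2, P.nil_mul_ι, P.ι_mul, TensorProduct.zero_tmul] at e1
      rw [boundaryTwo_tmul, P.ι_mul_nil, P.ι_mul_of_ne h2, P.nil_mul_ι,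
        TensorProduct.tmul_zero] at e2
      convert Submodule.sub_mem _ e2 e1 using 1
      abel
    · -- only `αβ` can be nonzero: `α ⊗ β` is homologous to `αβ ⊗ s(β)`
      subst h2
      rw [pairSum_of_not fun h => h1 h.1, map_zero, sub_zero, hβα h1, P.ι_mul,
        sub_zero, sourceTensor_ι, if_neg h1]
      have e := hmem (P.ι ⟨x', y, α⟩ ⊗ₜ (P.ι ⟨y', x', β⟩ ⊗ₜ P.ι ⟨y', y', Path.nil⟩))
      rw [boundaryTwo_tmul, P.ι_mul_nil, P.ι_mul_of_ne (q := ⟨y', y', Path.nil⟩) (Ne.symm h1),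
        P.ι_mul, TensorProduct.zero_tmul] at e
      convert Submodule.neg_mem _ e using 1
      abel
    · -- both products vanish, and `α ⊗ β` is the boundary of `-α ⊗ t(β) ⊗ β`
      rw [pairSum_of_not fun h => h1 h.1, map_zero, sub_zero, hβα h1,
        P.ι_mul_of_ne h2, sub_zero, map_zero, sub_zero]
      have e := hmem (P.ι ⟨x, y, α⟩ ⊗ₜ (P.ι ⟨x', x', Path.nil⟩ ⊗ₜ P.ι ⟨y', x', β⟩))
      rw [boundaryTwo_tmul, P.ι_mul_of_ne h2, P.nil_mul_ι, hβα h1,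
        TensorProduct.zero_tmul, TensorProduct.zero_tmul] at e
      convert Submodule.neg_mem _ e using 1
      abel
  exact (Submodule.Quotient.mk_eq_zero R).1 (LinearMap.congr_fun key x)

end PathBasis

end Comparison

/-! ### Cycles of the comparison complex -/

section CycleKernel

variable {k : Type w} [Field k] {V : Type u} [Quiver.{v} V] {Z : Set (QPath V)}

open Classical in
theorem initSingle_apply {γ δ : Cycle V} (hδ : δ ∈ initCycles Z) :
    initSingle k Z γ δ = if γ = δ then 1 else 0 := by
  by_cases h : γ ∈ initCycles Z
  · rw [initSingle_of_mem h, Finsupp.single_apply]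
  · rw [initSingle_of_notMem h, if_neg, Finsupp.zero_apply]
    rintro rfl
    exact h hδ

/-- The full sum of a cycle has the same coefficient, the exponent, at all the cycles of its circuit
with a nonzero initial part. -/
theorem fullSum_apply {γ δ : Cycle V} (hδ : δ ∈ initCycles Z) (h : γ.circuit = δ.circuit) :
    fullSum k Z γ δ = (γ.exponent : k) := by
  classical
  rw [Cycle.eq_of_circuit_eq (f := fullSum k Z) fullSum_rotate h,
    Cycle.eq_of_circuit_eq Cycle.exponent_rotate h, fullSum_eq_sum, Finsupp.finsetSum_apply,
    Cycle.exponent]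
  simp only [initSingle_apply hδ, Finset.sum_boole]

theorem fullSum_apply_of_ne {γ δ : Cycle V} (h : γ.circuit ≠ δ.circuit) :
    fullSum k Z γ δ = 0 := by
  rw [fullSum_eq_sum, Finsupp.finsetSum_apply]
  refine Finset.sum_eq_zero fun j _ => ?_
  rw [initSingle]
  split_ifs
  · refine Finsupp.single_eq_of_ne' ?_
    rintro rfl
    exact h (Cycle.circuit_iterate_rotate γ j).symm
  · rfl

theorem fullSum_apply_of_notMem (γ : Cycle V) {δ : Cycle V} (h : δ ∉ initCycles Z) :
    fullSum k Z γ δ = 0 :=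
  Finsupp.notMem_support_iff.1 fun h' =>
    h ((Finsupp.mem_supported k _).1 (rotationSum_mem_supported Path.nil γ.path) h')

theorem Cycle.toQPath_injective : Function.Injective (Cycle.toQPath (V := V)) := by
  rintro ⟨x, p⟩ ⟨y, q⟩ h
  simp only [Cycle.toQPath, QPath.mk.injEq] at h
  obtain ⟨rfl, -, h⟩ := h
  rw [eq_of_heq h]

namespace PathBasis

variable {A : Type*} [Ring A] [Algebra k A] (P : PathBasis k Z A)

open Classical in
theorem coord_ι (q : nonzeroPaths Z) (p : QPath V) :
    P.basis.coord q (P.ι p) = if p = q.1 then 1 else 0 := by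
  by_cases hp : p ∈ nonzeroPaths Z
  · have := P.basis.repr_self_apply ⟨p, hp⟩ q
    rw [P.basis_apply] at this
    rw [Module.Basis.coord_apply, this]
    simp [Subtype.ext_iff]
  · rw [P.ι_eq_zero p hp, map_zero, if_neg]
    rintro rfl
    exact hp q.2

theorem coord_cycleBoundary {γ : Cycle V} (h : γ.rotate.toQPath ∈ nonzeroPaths Z)
    (x : Cycle V →₀ k) :
    P.basis.coord ⟨γ.rotate.toQPath, h⟩ (P.cycleBoundary x) = x γ.rotate - x γ := by
  classical
  have key : P.basis.coord ⟨γ.rotate.toQPath, h⟩ ∘ₗ P.cycleBoundary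
      = Finsupp.lapply γ.rotate - Finsupp.lapply γ := by
    refine Finsupp.lhom_ext' fun δ => LinearMap.ext_ring ?_
    change P.basis.coord _ (P.cycleBoundary (Finsupp.single δ 1))
      = Finsupp.single δ 1 γ.rotate - Finsupp.single δ 1 γ
    rw [cycleBoundary_single, map_sub, coord_ι, coord_ι, Finsupp.single_apply,
      Finsupp.single_apply]
    simp only [Cycle.toQPath_injective.eq_iff, Cycle.rotate_injective.eq_iff]
  exact LinearMap.congr_fun key x

theorem cycleBoundary_eq_zero_iff {x : Cycle V →₀ k} :
    P.cycleBoundary x = 0 ↔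
      ∀ γ : Cycle V, γ.rotate.toQPath ∈ nonzeroPaths Z → x γ.rotate = x γ := by
  constructor
  · intro hx γ hγ
    have := P.coord_cycleBoundary hγ x
    rw [hx, map_zero] at this
    exact sub_eq_zero.1 this.symm
  · intro hx
    refine P.basis.forall_coord_eq_zero_iff.1 ?_
    rintro ⟨q, hq⟩
    by_cases h : ∃ γ : Cycle V, γ.rotate.toQPath = q
    · obtain ⟨γ, rfl⟩ := h
      rw [coord_cycleBoundary, hx γ hq, sub_self]
    · have key : P.basis.coord ⟨q, hq⟩ ∘ₗ P.cycleBoundary = 0 := by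
        refine Finsupp.lhom_ext' fun δ => LinearMap.ext_ring ?_
        change P.basis.coord _ (P.cycleBoundary (Finsupp.single δ 1)) = 0
        obtain ⟨γ, rfl⟩ := Cycle.exists_rotate_eq δ
        rw [cycleBoundary_single, map_sub, coord_ι, coord_ι, if_neg fun h' => h ⟨_, h'⟩,
          if_neg fun h' => h ⟨_, h'⟩, sub_zero]
      exact LinearMap.congr_fun key x

end PathBasis

theorem Arc.apply_eq {x : Cycle V →₀ k}
    (hx : ∀ γ : Cycle V, γ.rotate.toQPath ∈ nonzeroPaths Z → x γ.rotate = x γ)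
    {γ δ : Cycle V} (h : Arc Z γ δ) : x δ = x γ := by
  obtain ⟨j, rfl, h⟩ := h
  induction j with
  | zero => rfl
  | succ j ih =>
    have h' := h (j + 1) (Nat.succ_pos j) le_rfl
    rw [Function.iterate_succ_apply'] at h' ⊢
    rw [hx _ h', ih fun i hi hij => h i hi (by omega)]

end CycleKernel

/-! ### Heads of arcs and homology classes -/

section Heads

variable {V : Type u} [Quiver.{v} V]

open Classical in
/-- A cycle of a given circuit, which is taken in `W` if this is possible. -/
noncomputable def baseCycle (Z : Set (QPath V)) (C : Circuit V) : Cycle V :=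
  if h : (endCycles Z ∩ {γ | γ.circuit = C}).Nonempty then h.some else Quotient.out C

/-- The first cycles of the arcs: the cycles of `W`, and one cycle of each strong circuit. -/
def arcHeads (Z : Set (QPath V)) : Set (Cycle V) :=
  {γ | γ ∈ endCycles Z ∨ γ.circuit.IsStrong Z ∧ γ = baseCycle Z γ.circuit}

/-- The index set of a basis of the first homology: the non-trivial strong circuits, and, for each
efficient circuit `C`, the cycles of `W ∩ C` except one. -/
abbrev ClassIndex (Z : Set (QPath V)) : Type (max u v) :=
  strongCircuits Z ⊕ Σ C : efficientCircuits Z,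
    ((endCycles Z ∩ {γ | γ.circuit = C.1}) \ {baseCycle Z C.1} : Set (Cycle V))

variable {Z : Set (QPath V)}

theorem circuit_baseCycle (C : Circuit V) : (baseCycle Z C).circuit = C := by
  rw [baseCycle]
  split_ifs with h
  · exact h.some_mem.2
  · exact Cycle.circuit_out C

theorem baseCycle_mem (hZ : IsRelationSet Z) {C : Circuit V} (hC : C.IsEfficient Z) :
    baseCycle Z C ∈ endCycles Z := by
  rw [baseCycle, dif_pos (endCycles_nonempty hZ hC)]
  exact (endCycles_nonempty hZ hC).some_mem.1

theorem baseCycle_mem_initCycles_of_strong {C : Circuit V} (hC : C ∈ strongCircuits Z) :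
    baseCycle Z C ∈ initCycles Z := by
  refine mem_initCycles_of_nonzero (fun h => hC.1 ?_) (hC.2 _ (circuit_baseCycle C))
  rw [← circuit_baseCycle (Z := Z) C]
  exact (Cycle.circuit_isTrivial_iff _).2 h

theorem exists_arcHead (hZ : IsRelationSet Z) {γ : Cycle V} (hγ : γ ∈ initCycles Z) :
    ∃ δ ∈ arcHeads Z, Arc Z δ γ := by
  by_cases hC : γ.circuit.IsStrong Z
  · have hb : (baseCycle Z γ.circuit).circuit = γ.circuit := circuit_baseCycle _
    obtain ⟨j, hj⟩ := Cycle.circuit_eq_iff.1 hb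
    refine ⟨_, Or.inr ⟨hb.symm ▸ hC, by rw [hb]⟩, j, hj, fun i _ _ => hC _ ?_⟩
    rw [Cycle.circuit_iterate_rotate, hb]
  · obtain ⟨δ, hδ, h⟩ := exists_arc_of_not_isStrong hZ hγ hC
    exact ⟨δ, Or.inl hδ, h⟩

theorem arcHead_unique (hZ : IsRelationSet Z) {γ δ δ' : Cycle V} (hδ : δ ∈ arcHeads Z)
    (hδ' : δ' ∈ arcHeads Z) (h : Arc Z δ γ) (h' : Arc Z δ' γ) : δ = δ' := by
  have hc : δ.circuit = δ'.circuit := h.circuit_eq.trans h'.circuit_eq.symm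
  rcases hδ with hδ | ⟨hs, hδ⟩ <;> rcases hδ' with hδ' | ⟨hs', hδ'⟩
  · exact h.unique h' ((mem_endCycles_iff hZ).1 hδ).2 ((mem_endCycles_iff hZ).1 hδ').2
  · exact (((mem_endCycles_iff hZ).1 hδ).2 (hs' _ hc)).elim
  · exact (((mem_endCycles_iff hZ).1 hδ').2 (hs _ hc.symm)).elim
  · rw [hδ, hδ', hc]

namespace ClassIndex

/-- The cycle of an index. -/
noncomputable def cycle : ClassIndex Z → Cycle V
  | Sum.inl C => baseCycle Z C.1
  | Sum.inr q => q.2.1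

theorem circuit_cycle_inl (C : strongCircuits Z) :
    (cycle (Sum.inl C : ClassIndex Z)).circuit = C.1 := circuit_baseCycle _

theorem cycle_mem_initCycles (hZ : IsRelationSet Z) (i : ClassIndex Z) :
    i.cycle ∈ initCycles Z := by
  rcases i with C | ⟨C, γ⟩
  · exact baseCycle_mem_initCycles_of_strong C.2
  · exact ((mem_endCycles_iff hZ).1 γ.2.1.1).1

theorem cycle_mem_arcHeads (i : ClassIndex Z) : i.cycle ∈ arcHeads Z := by
  rcases i with C | ⟨C, γ⟩
  · refine Or.inr ?_
    rw [circuit_cycle_inl]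
    exact ⟨C.2.2, rfl⟩
  · exact Or.inl γ.2.1.1

theorem cycle_ne_baseCycle {C : Circuit V} (hC : C.IsEfficient Z) (i : ClassIndex Z) :
    i.cycle ≠ baseCycle Z C := by
  intro h
  have hc := congrArg Cycle.circuit h
  rw [circuit_baseCycle] at hc
  rcases i with D | ⟨⟨D, hD⟩, γ⟩
  · rw [circuit_cycle_inl] at hc
    exact hC.2.1 (hc ▸ D.2.2)
  · obtain rfl : D = C := γ.2.1.2.symm.trans hc
    exact γ.2.2 h

theorem cycle_injective : Function.Injective (cycle (Z := Z)) := by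
  rintro (C | ⟨⟨C, hC⟩, ⟨γ, hγ⟩⟩) (D | ⟨⟨D, hD⟩, ⟨δ, hδ⟩⟩) h
  · have hc := congrArg Cycle.circuit h
    rw [circuit_cycle_inl, circuit_cycle_inl] at hc
    exact congrArg Sum.inl (Subtype.ext hc)
  · have hc := congrArg Cycle.circuit h
    rw [circuit_cycle_inl] at hc
    exact (hD.2.1 ((show C.1 = D from hc.trans hδ.1.2) ▸ C.2.2)).elim
  · have hc := congrArg Cycle.circuit h
    rw [circuit_cycle_inl] at hc
    exact (hC.2.1 ((show D.1 = C from hc.symm.trans hγ.1.2) ▸ D.2.2)).elim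
  · obtain rfl : γ = δ := h
    obtain rfl : C = D := hγ.1.2.symm.trans hδ.1.2
    rfl

theorem finite_circuit_mem (s : Finset (Cycle V)) :
    {i : ClassIndex Z | ∃ γ ∈ s, i.cycle.circuit = γ.circuit}.Finite := by
  have h : (⋃ γ ∈ s, cycle (Z := Z) ⁻¹' {δ | δ.circuit = γ.circuit}).Finite :=
    s.finite_toSet.biUnion fun γ _ =>
      (Cycle.finite_circuit γ.circuit).preimage cycle_injective.injOn
  refine h.subset ?_
  rintro i ⟨γ, hγ, hi⟩
  exact Set.mem_biUnion (Finset.mem_coe.2 hγ) hi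

end ClassIndex

end Heads

section Coordinates

variable (k : Type w) [Field k] {V : Type u} [Quiver.{v} V] (Z : Set (QPath V))

/-- The coordinates of a homology class: the coefficient at a cycle of a strong circuit, and the
difference of the coefficients at a cycle of `W ∩ C` and at the base cycle of `C`. -/
noncomputable def classCoordFun (x : Cycle V →₀ k) : ClassIndex Z → k
  | Sum.inl C => x (baseCycle Z C.1)
  | Sum.inr q => x q.2.1 - x (baseCycle Z q.1.1)

variable {k Z}

theorem finite_support_classCoordFun (x : Cycle V →₀ k) :
    (Function.support (classCoordFun k Z x)).Finite := by
  refine (ClassIndex.finite_circuit_mem x.support).subset ?_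
  rintro (C | ⟨C, γ⟩) hi
  · exact ⟨baseCycle Z C.1, Finsupp.mem_support_iff.2 hi, rfl⟩
  · by_cases h : x γ.1 = 0
    · refine ⟨baseCycle Z C.1, Finsupp.mem_support_iff.2 fun h' => hi ?_, ?_⟩
      · change x γ.1 - x (baseCycle Z C.1) = 0
        rw [h, h', sub_zero]
      · rw [circuit_baseCycle]
        exact γ.2.1.2
    · exact ⟨γ.1, Finsupp.mem_support_iff.2 h, rfl⟩

variable (k Z) in
/-- The coordinates of homology classes, as a linear map. -/
noncomputable def classCoord : (Cycle V →₀ k) →ₗ[k] (ClassIndex Z →₀ k) where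
  toFun x := Finsupp.ofSupportFinite (classCoordFun k Z x) (finite_support_classCoordFun x)
  map_add' x y := by
    ext (C | q)
    · rfl
    · exact add_sub_add_comm _ _ _ _
  map_smul' c x := by
    ext (C | q)
    · rfl
    · exact (mul_sub _ _ _).symm

theorem classCoord_inl (x : Cycle V →₀ k) (C : strongCircuits Z) :
    classCoord k Z x (Sum.inl C) = x (baseCycle Z C.1) := rfl

theorem classCoord_inr (x : Cycle V →₀ k) (q) :
    classCoord k Z x (Sum.inr q) = x q.2.1 - x (baseCycle Z q.1.1) := rfl

theorem classCoord_eq_zero_of_mem (hZ : IsRelationSet Z) {x : Cycle V →₀ k}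
    (hx : x ∈ fullSumSpan k Z) : classCoord k Z x = 0 := by
  have h : fullSumSpan k Z ≤ LinearMap.ker (classCoord k Z) := by
    refine Submodule.span_le.2 ?_
    rintro _ ⟨γ, hγ, rfl⟩
    rw [SetLike.mem_coe, LinearMap.mem_ker]
    ext (C | ⟨⟨C, hC⟩, ⟨δ, hδ⟩⟩)
    · rw [classCoord_inl, fullSum_apply_of_ne, Finsupp.zero_apply]
      rw [circuit_baseCycle]
      intro h
      exact hγ (h ▸ C.2.2)
    · rw [classCoord_inr, Finsupp.zero_apply]
      dsimp only
      have hb : (baseCycle Z C).circuit = C := circuit_baseCycle C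
      have hδ' : δ.circuit = C := hδ.1.2
      by_cases h : γ.circuit = C
      · rw [fullSum_apply ((mem_endCycles_iff hZ).1 hδ.1.1).1 (h.trans hδ'.symm),
          fullSum_apply ((mem_endCycles_iff hZ).1 (baseCycle_mem hZ hC)).1 (h.trans hb.symm),
          sub_self]
      · rw [fullSum_apply_of_ne (hδ'.symm ▸ h), fullSum_apply_of_ne (hb.symm ▸ h), sub_self]
  exact h hx

/-- A cycle of the small complex whose coordinates vanish is, on each circuit, a multiple of the
full sum; this is where the exponents have to be invertible. -/
theorem mem_fullSumSpan_of_classCoord_eq_zero [CharZero k] (hZ : IsRelationSet Z)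
    {x : Cycle V →₀ k} (hE : x ∈ Finsupp.supported k k (initCycles Z))
    (hx : ∀ γ : Cycle V, γ.rotate.toQPath ∈ nonzeroPaths Z → x γ.rotate = x γ)
    (h0 : classCoord k Z x = 0) : x ∈ fullSumSpan k Z := by
  classical
  -- the coefficients are constant on each circuit, apart from the cycles outside `initCycles Z`
  have hbase : ∀ γ ∈ initCycles Z, x γ = x (baseCycle Z γ.circuit) := by
    intro γ hγ
    obtain ⟨δ, hδ, harc⟩ := exists_arcHead hZ hγ
    rw [harc.apply_eq hx, ← harc.circuit_eq]
    rcases hδ with hδ | ⟨-, hδ⟩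
    · by_cases hb : δ = baseCycle Z δ.circuit
      · rw [← hb]
      · have := DFunLike.congr_fun h0
          (Sum.inr ⟨⟨δ.circuit, isEfficient_of_mem_endCycles hZ hδ⟩, ⟨δ, ⟨hδ, rfl⟩, hb⟩⟩)
        rw [classCoord_inr, Finsupp.zero_apply] at this
        exact sub_eq_zero.1 this
    · rw [← hδ]
  have hsupp : ∀ γ ∈ x.support, γ ∈ initCycles Z := fun γ hγ =>
    (Finsupp.mem_supported k _).1 hE hγ
  have hnot : ∀ γ ∈ x.support, ¬ γ.circuit.IsStrong Z := by
    intro γ hγ hs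
    have hγ' := hsupp γ hγ
    have := DFunLike.congr_fun h0 (Sum.inl ⟨γ.circuit, fun ht =>
      length_ne_zero_of_mem_initCycles hγ' ((Cycle.circuit_isTrivial_iff γ).1 ht), hs⟩)
    rw [classCoord_inl, Finsupp.zero_apply, ← hbase γ hγ'] at this
    exact Finsupp.mem_support_iff.1 hγ this
  have hsum : x = ∑ C ∈ x.support.image Cycle.circuit,
      (x (baseCycle Z C) * ((baseCycle Z C).exponent : k)⁻¹) • fullSum k Z (baseCycle Z C) := by
    ext γ
    rw [Finsupp.finsetSum_apply]
    by_cases hγ : γ ∈ initCycles Z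
    · rw [Finset.sum_eq_single γ.circuit]
      · rw [Finsupp.smul_apply, fullSum_apply hγ (circuit_baseCycle _), smul_eq_mul, mul_assoc,
          inv_mul_cancel₀, mul_one, hbase γ hγ]
        rw [Nat.cast_ne_zero]
        refine Cycle.exponent_ne_zero ?_
        rw [Cycle.length_eq_of_circuit_eq (circuit_baseCycle γ.circuit)]
        exact length_ne_zero_of_mem_initCycles hγ
      · intro C _ hC
        rw [Finsupp.smul_apply, fullSum_apply_of_ne, smul_zero]
        rwa [circuit_baseCycle]
      · intro hC
        have hx0 : x γ = 0 := by
          by_contra h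
          exact hC (Finset.mem_image_of_mem _ (Finsupp.mem_support_iff.2 h))
        rw [← hbase γ hγ, hx0, zero_mul, zero_smul, Finsupp.zero_apply]
    · rw [Finset.sum_eq_zero fun C _ => by
        rw [Finsupp.smul_apply, fullSum_apply_of_notMem _ hγ, smul_zero]]
      by_contra h
      exact hγ (hsupp γ (Finsupp.mem_support_iff.2 h))
  rw [hsum]
  refine Submodule.sum_mem _ fun C hC => Submodule.smul_mem _ _ (fullSum_mem ?_)
  obtain ⟨γ, hγ, rfl⟩ := Finset.mem_image.1 hC
  rw [circuit_baseCycle]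
  exact hnot γ hγ

/-- All the coordinates are attained on the cycles of the small complex, namely by the functions
that are constant on arcs. -/
theorem exists_classCoord_eq (hZ : IsRelationSet Z) (y : ClassIndex Z →₀ k) :
    ∃ x ∈ Finsupp.supported k k (initCycles Z),
      (∀ γ : Cycle V, γ.rotate.toQPath ∈ nonzeroPaths Z → x γ.rotate = x γ) ∧
      classCoord k Z x = y := by
  classical
  choose! head hhead harc using fun (γ : Cycle V) (hγ : γ ∈ initCycles Z) => exists_arcHead hZ hγ
  have head_eq : ∀ γ ∈ initCycles Z, ∀ δ ∈ arcHeads Z, Arc Z δ γ → head γ = δ :=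
    fun γ hγ δ hδ h => arcHead_unique hZ (hhead γ hγ) hδ (harc γ hγ) h
  -- the function that is constant on each arc, with the value given by `y` at its head
  set z : Cycle V →₀ k := y.embDomain ⟨_, ClassIndex.cycle_injective⟩ with hz
  have hzi : ∀ i : ClassIndex Z, z i.cycle = y i := fun i =>
    Finsupp.embDomain_apply_self ⟨_, ClassIndex.cycle_injective⟩ y i
  set f : Cycle V → k := fun γ => if γ ∈ initCycles Z then z (head γ) else 0 with hf
  have hfin : (Function.support f).Finite := by
    refine (z.support.finite_toSet.biUnion fun δ _ =>
      Cycle.finite_circuit δ.circuit).subset fun γ hγ => ?_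
    have hγE : γ ∈ initCycles Z := by
      by_contra h
      exact hγ (if_neg h)
    rw [Function.mem_support, hf] at hγ
    simp only [if_pos hγE] at hγ
    exact Set.mem_biUnion (Finset.mem_coe.2 (Finsupp.mem_support_iff.2 hγ))
      (harc γ hγE).circuit_eq.symm
  have hval : ∀ γ ∈ initCycles Z, γ ∈ arcHeads Z → f γ = z γ := by
    intro γ hγ hγ'
    rw [hf]
    simp only [if_pos hγ]
    rw [head_eq γ hγ γ hγ' (Arc.refl γ)]
  refine ⟨Finsupp.ofSupportFinite f hfin, ?_, ?_, ?_⟩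
  · rw [Finsupp.mem_supported]
    intro γ hγ
    by_contra h
    exact Finsupp.mem_support_iff.1 (Finset.mem_coe.1 hγ) (if_neg h)
  · intro γ hγ
    change f γ.rotate = f γ
    rcases eq_or_ne γ.length 0 with h0 | h0
    · rw [Cycle.rotate_eq_self h0]
    · have hγE := mem_initCycles_of_rotate_nonzero h0 hγ
      have hγE' : γ.rotate ∈ initCycles Z :=
        mem_initCycles_of_nonzero (by rwa [Cycle.length_rotate]) hγ
      simp only [hf, if_pos hγE, if_pos hγE']
      rw [head_eq _ hγE' _ (hhead γ hγE) ((harc γ hγE).step hγ)]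
  · ext i
    have hi : f i.cycle = y i := by
      rw [hval _ (i.cycle_mem_initCycles hZ) i.cycle_mem_arcHeads, hzi]
    rcases i with C | ⟨⟨C, hC⟩, γ⟩
    · exact hi
    · have hb := baseCycle_mem hZ hC
      have hfb : f (baseCycle Z C) = 0 := by
        rw [hval _ ((mem_endCycles_iff hZ).1 hb).1 (Or.inl hb), hz]
        refine Finsupp.embDomain_of_notMem_range _ _ _ ?_
        rintro ⟨i, hi⟩
        exact i.cycle_ne_baseCycle hC hi
      rw [classCoord_inr]
      change f (ClassIndex.cycle (Sum.inr ⟨⟨C, hC⟩, γ⟩)) - f (baseCycle Z C) = _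
      rw [hi, hfb, sub_zero]

end Coordinates

/-! ### The dimension of the first Hochschild homology -/

section Dimension

open Hochschild

variable {k : Type w} [Field k] {V : Type u} [Quiver.{v} V] {Z : Set (QPath V)}
variable {A : Type*} [Ring A] [Algebra k A]

namespace PathBasis

variable (P : PathBasis k Z A)

/-- The coordinates of the class of a Hochschild cycle. -/
noncomputable def hochschildCoord :
    ↥(LinearMap.ker (boundaryOne k A)) →ₗ[k] (ClassIndex Z →₀ k) :=
  classCoord k Z ∘ₗ P.tensorCycle ∘ₗ (LinearMap.ker (boundaryOne k A)).subtype

theorem hochschildCoord_surjective (hZ : IsRelationSet Z) :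
    Function.Surjective P.hochschildCoord := by
  intro y
  obtain ⟨x, hE, hx, rfl⟩ := exists_classCoord_eq hZ y
  refine ⟨⟨P.cycleTensor x, ?_⟩, ?_⟩
  · rw [LinearMap.mem_ker, boundaryOne_cycleTensor, P.cycleBoundary_eq_zero_iff.2 hx, neg_zero]
  · change classCoord k Z (P.tensorCycle (P.cycleTensor x)) = _
    rw [P.tensorCycle_cycleTensor hZ hE]

theorem ker_hochschildCoord [CharZero k] (hZ : IsRelationSet Z) :
    LinearMap.ker P.hochschildCoord
      = (LinearMap.range (boundaryTwo k A)).submoduleOf (LinearMap.ker (boundaryOne k A)) := by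
  ext ⟨t, ht⟩
  rw [LinearMap.mem_ker] at ht
  rw [LinearMap.mem_ker, Submodule.submoduleOf, Submodule.mem_comap]
  change classCoord k Z (P.tensorCycle t) = 0 ↔ t ∈ _
  constructor
  · intro h
    have hb : P.cycleBoundary (P.tensorCycle t) = 0 := by
      rw [cycleBoundary_tensorCycle, ht, map_zero, neg_zero]
    have h1 := P.cycleTensor_mem (mem_fullSumSpan_of_classCoord_eq_zero hZ
      (P.tensorCycle_mem_supported t) (P.cycleBoundary_eq_zero_iff.1 hb) h)
    have h2 := P.sub_cycleTensor_tensorCycle_mem t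
    rw [ht, map_zero, sub_zero] at h2
    simpa using Submodule.add_mem _ h2 h1
  · intro h
    exact classCoord_eq_zero_of_mem hZ (P.tensorCycle_boundaryTwo_mem h)

/-- The first Hochschild homology has a basis indexed by the non-trivial strong circuits and, for
each efficient circuit `C`, by all the cycles of `W ∩ C` except one. -/
noncomputable def hh1Equiv [CharZero k] (hZ : IsRelationSet Z) :
    HH1 k A ≃ₗ[k] (ClassIndex Z →₀ k) :=
  (Submodule.quotEquivOfEq _ _ (P.ker_hochschildCoord hZ).symm).trans
    (P.hochschildCoord.quotKerEquivOfSurjective (P.hochschildCoord_surjective hZ))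

end PathBasis

theorem mk_classIndex (hZ : IsRelationSet Z) :
    Cardinal.mk (ClassIndex Z) = Cardinal.mk (strongCircuits Z) +
      Cardinal.sum fun C : efficientCircuits Z =>
        ((C.1.weight Z - 1 : ℕ) : Cardinal.{max u v}) := by
  rw [ClassIndex, ← Cardinal.add_def, Cardinal.mk_sigma]
  congr 2
  ext C
  have hfin := finite_endCycles_inter (Z := Z) C.1
  rw [← Set.cast_ncard hfin.sdiff, Set.ncard_sdiff_singleton_of_mem]
  · rfl
  · exact ⟨baseCycle_mem hZ C.2, circuit_baseCycle _⟩

theorem finite_circuits_of_finite_nonzeroPaths [Finite V] [∀ x y : V, Finite (x ⟶ y)]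
    (hB : (nonzeroPaths Z).Finite) :
    (strongCircuits Z).Finite ∧ (efficientCircuits Z).Finite := by
  have hE : (initCycles Z).Finite := by
    refine (hB.biUnion fun p _ => Set.finite_range
      fun a : p.tgt ⟶ p.src => (⟨p.src, p.path.cons a⟩ : Cycle V)).subset ?_
    rintro ⟨y, p⟩ hγ
    cases p with
    | nil => exact hγ.elim
    | cons p a => exact Set.mem_biUnion (mem_initCycles_cons.1 hγ) ⟨a, rfl⟩
  constructor
  · refine (hE.image Cycle.circuit).subset fun C hC => ?_
    exact ⟨_, baseCycle_mem_initCycles_of_strong hC, circuit_baseCycle C⟩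
  · refine (hE.image Cycle.circuit).subset fun C hC => ?_
    exact circuit_isUseful_iff.1 hC.1

theorem card_classIndex (hZ : IsRelationSet Z) (hS : (strongCircuits Z).Finite)
    (hE : (efficientCircuits Z).Finite) :
    Finite (ClassIndex Z) ∧ (Nat.card (ClassIndex Z) : ℤ) =
      (strongCircuits Z).ncard + (∑ᶠ C ∈ efficientCircuits Z, (C.weight Z : ℤ))
        - (efficientCircuits Z).ncard := by
  have := hS.to_subtype
  have := hE.fintype
  have hfin : ∀ C : efficientCircuits Z,
      Finite ((endCycles Z ∩ {γ | γ.circuit = C.1}) \ {baseCycle Z C.1} : Set (Cycle V)) :=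
    fun C => (finite_endCycles_inter C.1).sdiff.to_subtype
  refine ⟨inferInstance, ?_⟩
  have hcard : ∀ C : efficientCircuits Z, (Nat.card
      ((endCycles Z ∩ {γ | γ.circuit = C.1}) \ {baseCycle Z C.1} : Set (Cycle V)) : ℤ)
        = C.1.weight Z - 1 := by
    intro C
    have h1 := Set.ncard_sdiff_singleton_of_mem
      (show baseCycle Z C.1 ∈ endCycles Z ∩ {γ | γ.circuit = C.1} from
        ⟨baseCycle_mem hZ C.2, circuit_baseCycle _⟩)
    have h2 := one_le_weight hZ C.2
    rw [Nat.card_coe_set_eq, h1]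
    exact Nat.cast_sub h2
  rw [ClassIndex, Nat.card_sum, Nat.card_sigma, ← finsum_set_coe_eq_finsum_mem,
    finsum_eq_sum_of_fintype, ← Nat.card_coe_set_eq (efficientCircuits Z),
    Nat.card_eq_fintype_card (α := efficientCircuits Z), Nat.card_coe_set_eq]
  push_cast
  rw [Finset.sum_congr rfl fun C _ => hcard C, Finset.sum_sub_distrib]
  simp
  ring

end Dimension

end Monomial

open Monomial Hochschild in
theorem theorem2p13 {k : Type w} [Field k] [CharZero k]
    {V : Type u} [Quiver.{v} V] [Fintype V] [∀ x y : V, Finite (x ⟶ y)]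
    [Nonempty V] (hconn : Quiver.IsStronglyConnected (Quiver.Symmetrify V))
    (Z : Set (QPath V)) (hZ : IsRelationSet Z) :
    (∀ C ∈ efficientCircuits Z, 1 ≤ C.weight Z) ∧
    Module.rank k (HH1 k (MonomialAlgebra k Z)) =
      Cardinal.lift.{w} (Cardinal.mk (strongCircuits Z) +
        Cardinal.sum fun C : efficientCircuits Z => ((C.1.weight Z - 1 : ℕ) : Cardinal.{max u v})) ∧
    ((strongCircuits Z).Finite → (efficientCircuits Z).Finite →
      Module.Finite k (HH1 k (MonomialAlgebra k Z)) ∧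
      (Module.finrank k (HH1 k (MonomialAlgebra k Z)) : ℤ) =
        (strongCircuits Z).ncard + (∑ᶠ C ∈ efficientCircuits Z, (C.weight Z : ℤ))
          - (efficientCircuits Z).ncard) ∧
    (Module.Finite k (MonomialAlgebra k Z) →
      (strongCircuits Z).Finite ∧ (efficientCircuits Z).Finite) := by
  have P := monomialPathBasis k Z
  refine ⟨fun C hC => one_le_weight hZ hC, ?_, fun hS hE => ?_, fun _ => ?_⟩
  · rw [(P.hh1Equiv hZ).rank_eq, rank_finsupp_self, mk_classIndex hZ]
  · obtain ⟨_, hcard⟩ := card_classIndex hZ hS hE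
    have := Fintype.ofFinite (ClassIndex Z)
    refine ⟨Module.Finite.equiv (P.hh1Equiv hZ).symm, ?_⟩
    rw [(P.hh1Equiv hZ).finrank_eq, Module.finrank_finsupp_self, ← Nat.card_eq_fintype_card, hcard]
  · have := Module.Finite.finite_basis P.basis
    exact finite_circuits_of_finite_nonzeroPaths (Set.toFinite _)
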